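/- Let $N$ be a finite simple plane graph, let $\varphi$ be a proper $5$-coloring of $N$, and let $I$ be an independent set of vertices of $N$, each of degree at most $6$ and all having the same color $a$ in $\varphi$ (if $I=\emptyset$, $a$ is an arbitrary color). A Kempe change on a coloring swaps two distinct colors $b,c$ on a Kempe chain, i.e. on a maximal connected subgraph all of whose vertices have color $b$ or $c$. For a $5$-coloring $\psi$ of $N$, a vertex $v$ of degree $6$ is called $\psi$-good if $v$ has three neighbors of the same color in $\psi$, or $v$ has four distinct neighbors $x,y,z,t$ with $\psi(x)=\psi(y)$ and $\psi(z)=\psi(t)$ such that the graph $N-v+xy+zt$ is planar. Then there are a proper $5$-coloring $\psi$ of $N$ such that every vertex of $I$ of degree exactly $6$ is $\psi$-good, and a finite sequence of Kempe changes from $\varphi$ to $\psi$ such that no vertex ever changes its color to $a$, no vertex of $I$ is ever recolored, and every vertex of $N$ changes its color at most $3|I|$ times. -/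

import Mathlib

namespace Kempe

/-- A rotation system on `G`: a permutation of the darts (oriented edges) whose cycles are exactly
the sets of darts leaving a common vertex. It records the cyclic order of the edges around each
vertex in a drawing of `G`. -/
structure RotationSystem {V : Type*} (G : SimpleGraph V) where
  /-- The next dart in the cyclic order around the initial vertex of a dart. -/
  next : Equiv.Perm G.Dart
  next_fst : ∀ d : G.Dart, (next d).fst = d.fst
  sameCycle : ∀ d e : G.Dart, d.fst = e.fst → next.SameCycle d e

namespace RotationSystem

variable {V : Type*} {G : SimpleGraph V}

/-- The face-tracing permutation: traverse the dart `d`, then leave its terminal vertex along the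
dart that follows the reversal of `d` in the cyclic order there. -/
def facePerm (R : RotationSystem G) : Equiv.Perm G.Dart :=
  (SimpleGraph.Dart.symm_involutive (G := G)).toPerm.trans R.next

/-- The total number of faces when every connected component is drawn on its own surface: the
cycles of the face-tracing permutation, and one face for every isolated vertex. -/
noncomputable def numFaces (R : RotationSystem G) : ℕ :=
  Nat.card (Quotient (Equiv.Perm.SameCycle.setoid R.facePerm)) +
    Nat.card {v : V // ∀ w, ¬ G.Adj v w}

/-- Every connected component has genus `0`, by Euler's formula `|V| - |E| + |F| = 2` summed over
the components. (For each component `|V| - |E| + |F| ≤ 2`, so equality of the sums means equality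
for every component.) -/
def IsPlane (R : RotationSystem G) : Prop :=
  Nat.card V + R.numFaces = Nat.card G.edgeSet + 2 * Nat.card G.ConnectedComponent

end RotationSystem

/-- A finite graph is planar if it has a plane embedding, that is, a rotation system of genus `0`.
-/
def IsPlanar {V : Type*} [Finite V] (G : SimpleGraph V) : Prop :=
  ∃ R : RotationSystem G, R.IsPlane

section Colorings

variable {V : Type*} {G : SimpleGraph V} {k : ℕ}

/-- `B` is the vertex set of a Kempe chain of `φ` in the colors `{a, b}`: a maximal connected
subgraph all of whose vertices have color `a` or `b`. -/
def IsKempeChain (φ : G.Coloring (Fin k)) (a b : Fin k) (B : Set V) : Prop :=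
  Maximal (fun S : Set V => (G.induce S).Connected ∧ ∀ w ∈ S, φ w = a ∨ φ w = b) B

/-- `ψ` arises from `φ` by a single Kempe change: two distinct colors `a` and `b` are swapped on
one Kempe chain in the colors `{a, b}`. -/
def KempeChange (φ ψ : G.Coloring (Fin k)) : Prop :=
  ∃ (a b : Fin k) (B : Set V), a ≠ b ∧ IsKempeChain φ a b B ∧
    (∀ w ∈ B, ψ w = Equiv.swap a b (φ w)) ∧ ∀ w, w ∉ B → ψ w = φ w

/-- The pairs `(a, b)` and `(c, d)` of vertices of `G - v` are non-overlapping: the graph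
`G - v + ab + cd` is planar. -/
def NonOverlapping [Finite V] (G : SimpleGraph V) (v : V) (a b c d : ({v}ᶜ : Set V)) : Prop :=
  IsPlanar (G.induce ({v}ᶜ : Set V) ⊔ SimpleGraph.edge a b ⊔ SimpleGraph.edge c d)

/-- `v` is `φ`-good (used for vertices of degree `6`): it has three neighbors colored alike, or two
disjoint non-overlapping pairs of neighbors, each pair colored alike. -/
def IsGood [Finite V] (φ : G.Coloring (Fin k)) (v : V) : Prop :=
  (∃ x y z : V, G.Adj v x ∧ G.Adj v y ∧ G.Adj v z ∧ x ≠ y ∧ x ≠ z ∧ y ≠ z ∧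
    φ x = φ y ∧ φ x = φ z) ∨
  ∃ a b c d : ({v}ᶜ : Set V), G.Adj v a ∧ G.Adj v b ∧ G.Adj v c ∧ G.Adj v d ∧
    [a, b, c, d].Nodup ∧ φ a = φ b ∧ φ c = φ d ∧ NonOverlapping G v a b c d

end Colorings

end Kempe

namespace Kempe

/-! Call the vertices of `I` of degree 6 hubs. All hubs have color `α`, so their neighbors use the
four other colors. If every Kempe change avoids `α`, then no hub is recolored and no vertex becomes
`α`. The hubs are treated one at a time, at the cost of at most three changes per vertex for each
hub.

At one hub, only the cyclic pattern of six colors matters. Up to the symmetries of the hexagon, a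
pattern is either good already or one of four bad types. Each bad type is repaired in at most three
swaps, because chains in complementary pairs of the four colors cannot cross (`HexGame.wins_three`).

Later work must not destroy earlier success. So when a hub has become good, the pairs of equally
colored neighbors witnessing this are glued: from then on a chain may jump between them, and glued
chains are swapped as a whole. Such a chain is a union of ordinary Kempe chains, so each vertex
still changes at most once per swap. Glued neighbors stay alike, and the hub stays good whatever
colors they take. Gluing amounts to running through the hub; the glued pairs at one hub do not
cross, so chains in disjoint color pairs still cannot cross (`not_linked_of_linked`).

Topology enters through mod 2 homology. By Euler's formula and rank counting, a rotation system has
genus 0 exactly when every mod 2 cycle is the boundary of a set of faces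
(`RotationSystem.isPlane_iff`). This replaces the Jordan curve theorem in the separation argument.
It also shows that two noncrossing chords can be drawn through a deleted hub
(`nonOverlapping_of_cross`), which turns good patterns into good vertices. -/

/-- The `ZMod 2`-valued functions that are constant on the classes of a setoid. -/
def invariants {X : Type*} (r : Setoid X) : Submodule (ZMod 2) (X → ZMod 2) where
  carrier := {f | ∀ x y, r x y → f x = f y}
  add_mem' hf hg x y h := congrArg₂ (· + ·) (hf x y h) (hg x y h)
  zero_mem' _ _ _ := rfl
  smul_mem' c _ hf x y h := congrArg (c * ·) (hf x y h)

theorem finrank_invariants {X : Type*} [Finite X] (r : Setoid X) :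
    Module.finrank (ZMod 2) (invariants r) = Nat.card (Quotient r) := by
  have : invariants r =
      LinearMap.range (LinearMap.funLeft (ZMod 2) (ZMod 2) (Quotient.mk r)) := by
    ext f
    constructor
    · intro hf
      exact ⟨Quotient.lift f hf, rfl⟩
    · rintro ⟨g, rfl⟩ x y h
      exact congrArg g (Quotient.sound h)
  have := Fintype.ofFinite (Quotient r)
  rw [‹invariants r = _›, LinearMap.finrank_range_of_inj
    (LinearMap.funLeft_injective_of_surjective _ _ _ Quotient.mk_surjective),
    Module.finrank_fintype_fun_eq_card, Nat.card_eq_fintype_card]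

theorem finrank_map_add_finrank_inf_ker {K M M' : Type*} [Field K] [AddCommGroup M] [Module K M]
    [AddCommGroup M'] [Module K M'] [FiniteDimensional K M] (T : M →ₗ[K] M')
    (S : Submodule K M) :
    Module.finrank K (S.map T) + Module.finrank K (S ⊓ LinearMap.ker T : Submodule K M) =
      Module.finrank K S := by
  rw [← LinearMap.finrank_range_add_finrank_ker (T.domRestrict S), LinearMap.range_domRestrict,
    LinearMap.ker_domRestrict, ← Submodule.finrank_map_subtype_eq, Submodule.map_comap_subtype]

/-! ### Mod 2 homology of rotation systems. -/

section Homology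

variable {V : Type*} {G : SimpleGraph V}

/-- The symmetric functions on darts, that is, the functions on edges. -/
def symmetricChains (G : SimpleGraph V) : Submodule (ZMod 2) (G.Dart → ZMod 2) :=
  invariants (Setoid.ker fun d : G.Dart => d.edge)

theorem mem_symmetricChains {z : G.Dart → ZMod 2} :
    z ∈ symmetricChains G ↔ ∀ d, z d.symm = z d := by
  constructor
  · intro h d
    exact h _ _ (by simp [Setoid.ker_def])
  · intro h d e hde
    obtain rfl | rfl := (SimpleGraph.dart_edge_eq_iff d e).1 hde
    · rfl
    · exact h e

/-- Adding up the two darts of every edge. -/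
def symmetrize (G : SimpleGraph V) : (G.Dart → ZMod 2) →ₗ[ZMod 2] (G.Dart → ZMod 2) :=
  LinearMap.id + LinearMap.funLeft _ _ SimpleGraph.Dart.symm

@[simp]
theorem symmetrize_apply (f : G.Dart → ZMod 2) (d : G.Dart) :
    symmetrize G f d = f d + f d.symm := rfl

open scoped Classical in
/-- The chain of a single edge. -/
noncomputable def edgeChain (e : G.Dart) : G.Dart → ZMod 2 :=
  fun d => if d = e ∨ d = e.symm then 1 else 0

theorem edgeChain_symm (e d : G.Dart) : edgeChain e d.symm = edgeChain e d := by
  unfold edgeChain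
  congr 1
  rw [eq_iff_iff, or_comm]
  exact or_congr SimpleGraph.Dart.symm_involutive.injective.eq_iff
    (SimpleGraph.Dart.symm_involutive.eq_iff)

theorem edgeChain_ne {e d : G.Dart} (h : d ≠ e) (h' : d ≠ e.symm) : edgeChain e d = 0 :=
  if_neg (by tauto)

/-- The two darts of an edge contribute equally and so cancel mod 2; no dart is its own reversal. -/
theorem sum_eq_zero_of_symm {z : G.Dart → ZMod 2} [Fintype G.Dart] (P : G.Dart → Prop)
    [DecidablePred P]
    (hz : ∀ d, z d.symm = z d) (hP : ∀ d : G.Dart, P d.symm ↔ P d) :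
    ∑ d : G.Dart, (if P d then z d else 0) = 0 := by
  classical
  refine Finset.sum_involution (fun d _ => d.symm) ?_ ?_ ?_ ?_
  · intro d _
    simp only [hz, hP]
    exact CharTwo.add_self_eq_zero _
  · intro d _ _
    exact d.symm_ne
  · simp
  · simp

namespace RotationSystem

variable (R : RotationSystem G)

/-- The functions on darts that are constant on the faces. -/
def faceChains : Submodule (ZMod 2) (G.Dart → ZMod 2) :=
  invariants (Equiv.Perm.SameCycle.setoid R.facePerm)

theorem apply_eq_of_sameCycle {X Y : Type*} {σ : Equiv.Perm X} {f : X → Y}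
    (h : ∀ x, f (σ x) = f x) {x y : X} (hxy : σ.SameCycle x y) : f x = f y := by
  obtain ⟨n, rfl⟩ := hxy
  have hi : ∀ x, f (σ⁻¹ x) = f x := fun x => by rw [← h (σ⁻¹ x), ← Equiv.Perm.mul_apply, mul_inv_cancel, Equiv.Perm.one_apply]
  induction n with
  | zero => rfl
  | succ n ih => rw [add_comm, zpow_add, zpow_one, Equiv.Perm.mul_apply, h, ih]
  | pred n ih => rw [sub_eq_neg_add, zpow_add, zpow_neg_one, Equiv.Perm.mul_apply, hi, ih]

theorem mem_faceChains {f : G.Dart → ZMod 2} :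
    f ∈ R.faceChains ↔ ∀ d, f (R.next d.symm) = f d := by
  constructor
  · intro h d
    exact (h d _ (Equiv.Perm.sameCycle_apply_right.2 (Equiv.Perm.SameCycle.refl _ _))).symm
  · intro h d e hde
    exact apply_eq_of_sameCycle (σ := R.facePerm) h hde

theorem apply_eq_of_fst_eq {f : G.Dart → ZMod 2} {p : V}
    (h : ∀ d : G.Dart, d.fst = p → f (R.next d) = f d) {d e : G.Dart} (hd : d.fst = p)
    (he : e.fst = p) : f d = f e := by
  classical
  -- Extending by 0 away from `p` makes the function invariant under `R.next` everywhere, so the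
  -- hypothesis is needed only at `p`.
  have := apply_eq_of_sameCycle (f := fun d : G.Dart => if d.fst = p then f d else 0)
    (fun d => by
      simp only [R.next_fst]
      split_ifs with h1
      · exact h d h1
      · rfl) (R.sameCycle d e (hd.trans he.symm))
  simpa [hd, he] using this

/-- If `f` agrees on the two sides of every edge and is constant on faces, then it is constant
around each vertex and along each edge, hence on components. -/
theorem faceChains_inf_ker_symmetrize :
    R.faceChains ⊓ LinearMap.ker (symmetrize G) =
      invariants (Setoid.ker fun d : G.Dart => G.connectedComponentMk d.fst) := by
  ext f
  rw [Submodule.mem_inf, mem_faceChains, LinearMap.mem_ker]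
  constructor
  · rintro ⟨h1, h2⟩ d e hde
    have hs : ∀ d, f d.symm = f d := fun d => (CharTwo.add_eq_zero.1 (congrFun h2 d)).symm
    have hn : ∀ d, f (R.next d) = f d := fun d => by
      rw [← hs d, ← h1 d.symm, SimpleGraph.Dart.symm_symm]
    obtain ⟨w⟩ := SimpleGraph.ConnectedComponent.eq.1 hde
    have key : ∀ (p q : V), G.Walk p q → ∀ d e : G.Dart, d.fst = p → e.fst = q → f d = f e := by
      intro p q w
      induction w with
      | nil =>
        intro d e hd he
        exact R.apply_eq_of_fst_eq (fun d _ => hn d) hd he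
      | @cons a b c hab w ih =>
        intro d e hd he
        rw [← ih ⟨(b, a), hab.symm⟩ e rfl he,
          R.apply_eq_of_fst_eq (fun d _ => hn d) hd (e := ⟨(a, b), hab⟩) rfl]
        exact (hs ⟨(a, b), hab⟩).symm
    exact key _ _ w d e rfl rfl
  · intro h
    have hs : ∀ d, f d.symm = f d := fun d =>
      h _ _ (SimpleGraph.ConnectedComponent.eq.2 d.symm.adj.reachable)
    refine ⟨fun d => ?_, ?_⟩
    · rw [← hs d]
      refine h _ _ ?_
      rw [Setoid.ker_def, R.next_fst]
    · ext d
      simp [hs, CharTwo.add_self_eq_zero]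

end RotationSystem

variable [Fintype V]

instance : Finite G.Dart :=
  Finite.of_injective _ SimpleGraph.Dart.toProd_injective

open scoped Classical in
/-- The boundary of a symmetric chain, as a linear map on all functions on darts. -/
noncomputable def boundary (G : SimpleGraph V) : (G.Dart → ZMod 2) →ₗ[ZMod 2] (V → ZMod 2) where
  toFun z p := ∑ d : G.Dart, if d.fst = p then z d else 0
  map_add' z z' := by
    ext p
    simp only [Pi.add_apply, ← Finset.sum_add_distrib]
    exact Finset.sum_congr rfl fun d _ => by split_ifs <;> simp
  map_smul' c z := by
    ext p
    simp only [Pi.smul_apply, smul_eq_mul, RingHom.id_apply, Finset.mul_sum]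
    exact Finset.sum_congr rfl fun d _ => by split_ifs <;> simp

open scoped Classical in
theorem boundary_apply (z : G.Dart → ZMod 2) (p : V) :
    boundary G z p = ∑ d : G.Dart, if d.fst = p then z d else 0 := rfl

theorem finrank_symmetricChains :
    Module.finrank (ZMod 2) (symmetricChains G) = Nat.card G.edgeSet := by
  rw [symmetricChains, finrank_invariants]
  refine Nat.card_congr ((Setoid.quotientKerEquivRange _).trans (Equiv.setCongr ?_))
  ext e
  constructor
  · rintro ⟨d, rfl⟩
    exact d.edge_mem
  · induction e with | _ a b
    intro h
    exact ⟨⟨(a, b), h⟩, rfl⟩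

open scoped Classical in
theorem boundary_edgeChain (e : G.Dart) (p : V) :
    boundary G (edgeChain e) p = (if p = e.fst then 1 else 0) + if p = e.snd then 1 else 0 := by
  have h : ∀ d : G.Dart, (if d.fst = p then edgeChain e d else 0) =
      (if d = e then (if p = e.fst then 1 else 0) else 0) +
        if d = e.symm then (if p = e.snd then 1 else 0) else 0 := by
    intro d
    have hne : e ≠ e.symm := e.symm_ne.symm
    by_cases h1 : d = e
    · subst h1
      simp [edgeChain, hne, eq_comm]
    · by_cases h2 : d = e.symm
      · subst h2
        simp [edgeChain, hne.symm, eq_comm]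
      · simp [edgeChain, h1, h2]
  rw [boundary_apply, Finset.sum_congr rfl fun d _ => h d, Finset.sum_add_distrib]
  simp

open scoped Classical in
/-- Adding up a function over each connected component. -/
noncomputable def componentSum (G : SimpleGraph V) :
    (V → ZMod 2) →ₗ[ZMod 2] (G.ConnectedComponent → ZMod 2) where
  toFun h C := ∑ p : V, if G.connectedComponentMk p = C then h p else 0
  map_add' z z' := by
    ext p
    simp only [Pi.add_apply, ← Finset.sum_add_distrib]
    exact Finset.sum_congr rfl fun d _ => by split_ifs <;> simp
  map_smul' c z := by
    ext p
    simp only [Pi.smul_apply, smul_eq_mul, RingHom.id_apply, Finset.mul_sum]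
    exact Finset.sum_congr rfl fun d _ => by split_ifs <;> simp

theorem componentSum_surjective : Function.Surjective (componentSum G) := by
  classical
  intro g
  refine ⟨fun p => if p = (G.connectedComponentMk p).out then g (G.connectedComponentMk p) else 0,
    ?_⟩
  ext C
  have hout : G.connectedComponentMk C.out = C := Quot.out_eq C
  change ∑ p : V, _ = _
  rw [Finset.sum_eq_single C.out]
  · simp [hout]
  · intro p _ hp
    refine ite_eq_right_iff.2 fun h1 => if_neg fun h2 => hp ?_
    rw [h2, h1]
  · simp

theorem pi_add_self {X : Type*} (f : X → ZMod 2) : f + f = 0 :=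
  funext fun _ => CharTwo.add_self_eq_zero _

/-- An edge has its two ends in one component, so boundaries have component sum zero. Conversely,
the edges of a walk add up to a chain bounded by its ends, and such pairs of points span the
functions of component sum zero. -/
theorem map_boundary_symmetricChains :
    (symmetricChains G).map (boundary G) = LinearMap.ker (componentSum G) := by
  classical
  apply le_antisymm
  · rintro _ ⟨z, hz, rfl⟩
    rw [LinearMap.mem_ker]
    ext C
    change ∑ p : V, (if G.connectedComponentMk p = C then boundary G z p else 0) = 0
    have h : ∀ p : V, (if G.connectedComponentMk p = C then boundary G z p else 0) =
        ∑ d : G.Dart, if d.fst = p then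
          (if G.connectedComponentMk d.fst = C then z d else 0) else 0 := by
      intro p
      rw [boundary_apply]
      split_ifs with hp
      · refine Finset.sum_congr rfl fun d _ => ?_
        split_ifs with h1 h2
        · rfl
        · exact absurd (h1 ▸ hp) h2
        · rfl
      · symm
        refine Finset.sum_eq_zero fun d _ => ?_
        split_ifs with h1 h2
        · exact absurd (h1 ▸ h2) hp
        · rfl
        · rfl
    rw [Finset.sum_congr rfl fun p _ => h p, Finset.sum_comm]
    simp only [Finset.sum_ite_eq, Finset.mem_univ, if_true]
    refine sum_eq_zero_of_symm _ (mem_symmetricChains.1 hz) fun d => ?_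
    rw [SimpleGraph.ConnectedComponent.eq.2 d.symm.adj.reachable]
    rfl
  · intro h hh
    have key : ∀ p q : V, G.Reachable p q →
        (Pi.single p 1 + Pi.single q 1 : V → ZMod 2) ∈
          (symmetricChains G).map (boundary G) := by
      rintro p q ⟨w⟩
      induction w with
      | nil => rw [pi_add_self]; exact zero_mem _
      | @cons a b c hab w ih =>
        have h1 : (Pi.single a 1 + Pi.single b 1 : V → ZMod 2) ∈
            (symmetricChains G).map (boundary G) := by
          refine ⟨edgeChain ⟨(a, b), hab⟩, mem_symmetricChains.2 (edgeChain_symm _), ?_⟩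
          ext p
          rw [boundary_edgeChain]
          simp [Pi.single_apply]
        have h2 := add_mem h1 ih
        rwa [add_assoc, ← add_assoc (Pi.single b 1 : V → ZMod 2), pi_add_self,
          zero_add] at h2
    -- Every point is paired with the representative of its component; the representative terms
    -- cancel because `h` sums to zero there.
    have hsum : h = ∑ p : V, h p • (Pi.single p 1 +
        Pi.single (G.connectedComponentMk p).out 1 : V → ZMod 2) := by
      ext q
      simp only [smul_add, Finset.sum_add_distrib, Pi.add_apply, Finset.sum_apply, Pi.smul_apply,
        Pi.single_apply, smul_eq_mul, mul_ite, mul_one, mul_zero, Finset.sum_ite_eq,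
        Finset.mem_univ, if_true, left_eq_add]
      have h0 : ∑ p : V, (if G.connectedComponentMk p = G.connectedComponentMk q then h p else 0)
        = 0 := congrFun (LinearMap.mem_ker.1 hh) (G.connectedComponentMk q)
      by_cases hq : q = (G.connectedComponentMk q).out
      · refine Eq.trans ?_ h0
        refine Finset.sum_congr rfl fun p _ => ?_
        refine if_congr ?_ rfl rfl
        constructor
        · intro h1
          conv_rhs => rw [h1]
          exact (Quot.out_eq _).symm
        · intro h1
          rw [h1]
          exact hq
      · refine Finset.sum_eq_zero fun p _ => if_neg fun h1 => hq ?_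
        conv_lhs => rw [h1]
        congr 1
        rw [h1]
        exact (Quot.out_eq _).symm
    rw [hsum]
    refine sum_mem fun p _ => Submodule.smul_mem _ _ (key _ _ ?_)
    exact SimpleGraph.ConnectedComponent.eq.1 (Quot.out_eq (G.connectedComponentMk p)).symm

theorem finrank_map_boundary :
    Module.finrank (ZMod 2) ((symmetricChains G).map (boundary G)) +
      Nat.card G.ConnectedComponent = Nat.card V := by
  classical
  have h := LinearMap.finrank_range_add_finrank_ker (componentSum G)
  rw [LinearMap.range_eq_top.2 componentSum_surjective, finrank_top] at h
  have := Fintype.ofFinite G.ConnectedComponent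
  rw [Module.finrank_fintype_fun_eq_card, Module.finrank_fintype_fun_eq_card] at h
  rw [map_boundary_symmetricChains, Nat.card_eq_fintype_card, Nat.card_eq_fintype_card]
  omega

namespace RotationSystem

variable (R : RotationSystem G)

/-- A component without darts is an isolated vertex, which is why `numFaces` gives each of these a
face of its own. -/
theorem finrank_faceChains_inf_ker_symmetrize :
    Module.finrank (ZMod 2) (R.faceChains ⊓ LinearMap.ker (symmetrize G) :
      Submodule (ZMod 2) (G.Dart → ZMod 2)) + Nat.card {v : V // ∀ w, ¬ G.Adj v w} =
      Nat.card G.ConnectedComponent := by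
  rw [faceChains_inf_ker_symmetrize, finrank_invariants,
    Nat.card_congr (Setoid.quotientKerEquivRange fun d : G.Dart => G.connectedComponentMk d.fst),
    ← Nat.card_sum]
  refine Nat.card_eq_of_bijective
    (Sum.elim (fun C => C.1) fun v => G.connectedComponentMk v.1) ⟨?_, ?_⟩
  · have iso : ∀ v : {v : V // ∀ w, ¬ G.Adj v w}, ∀ q, G.connectedComponentMk v.1 =
        G.connectedComponentMk q → q = v.1 := by
      intro v q h
      obtain ⟨w⟩ := SimpleGraph.ConnectedComponent.eq.1 h
      cases w with
      | nil => rfl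
      | cons h' _ => exact absurd h' (v.2 _)
    rintro (⟨_, d, rfl⟩ | v) (⟨_, e, rfl⟩ | v') h
    · exact congrArg Sum.inl (Subtype.ext h)
    · exact absurd d.adj (iso v' _ (Eq.symm h) ▸ v'.2 _)
    · exact absurd e.adj (iso v _ h ▸ v.2 _)
    · exact congrArg _ (Subtype.ext (iso v _ h).symm)
  · intro C
    induction C using SimpleGraph.ConnectedComponent.ind with | _ v
    by_cases hv : ∀ w, ¬ G.Adj v w
    · exact ⟨Sum.inr ⟨v, hv⟩, rfl⟩
    · push Not at hv
      obtain ⟨w, hw⟩ := hv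
      exact ⟨Sum.inl ⟨_, ⟨(v, w), hw⟩, rfl⟩, rfl⟩

/-- Face boundaries are cycles: at a vertex, the values on reversed darts are those on the darts
shifted by one rotation step, so the two sums cancel. -/
theorem map_symmetrize_faceChains_le :
    R.faceChains.map (symmetrize G) ≤ symmetricChains G ⊓ LinearMap.ker (boundary G) := by
  classical
  rintro _ ⟨f, hf, rfl⟩
  have hf' := R.mem_faceChains.1 hf
  refine ⟨mem_symmetricChains.2 fun d => by simp [add_comm], ?_⟩
  change boundary G _ = 0
  ext p
  rw [boundary_apply]
  have : ∀ d : G.Dart, (if d.fst = p then symmetrize G f d else 0) =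
      (if d.fst = p then f d else 0) + if (R.next d).fst = p then f (R.next d) else 0 := by
    intro d
    rw [R.next_fst, symmetrize_apply, ← hf' d.symm, SimpleGraph.Dart.symm_symm]
    split_ifs <;> simp
  rw [Finset.sum_congr rfl fun d _ => this d, Finset.sum_add_distrib,
    Equiv.sum_comp R.next fun d => if d.fst = p then f d else 0, CharTwo.add_self_eq_zero]
  rfl

/-- A rotation system has genus `0` if and only if every cycle separates, that is, the faces can be
colored with two colors so that the edges of the cycle are those between differently colored
faces. -/
theorem isPlane_iff : R.IsPlane ↔ ∀ z : G.Dart → ZMod 2, (∀ d, z d.symm = z d) →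
    (∀ p, boundary G z p = 0) →
      ∃ f : G.Dart → ZMod 2, (∀ d, f (R.next d) = f d + z d) ∧ ∀ d, f d + f d.symm = z d := by
  have h1 := finrank_map_add_finrank_inf_ker (symmetrize G) R.faceChains
  have h2 := finrank_map_add_finrank_inf_ker (boundary G) (symmetricChains G)
  have h3 := R.finrank_faceChains_inf_ker_symmetrize
  have h4 := finrank_map_boundary (G := G)
  rw [finrank_symmetricChains] at h2
  rw [show Module.finrank (ZMod 2) R.faceChains = _ from finrank_invariants _] at h1
  -- Both ranks are now known, and Euler's formula says exactly that they agree; given the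
  -- inclusion, this is equality of the subspaces.
  have key : R.IsPlane ↔ R.faceChains.map (symmetrize G) =
      symmetricChains G ⊓ LinearMap.ker (boundary G) := by
    rw [IsPlane, numFaces]
    constructor
    · intro h
      exact Submodule.eq_of_le_of_finrank_eq R.map_symmetrize_faceChains_le (by omega)
    · intro h
      rw [h] at h1
      omega
  rw [key]
  constructor
  · intro h z hz hb
    have : z ∈ symmetricChains G ⊓ LinearMap.ker (boundary G) :=
      ⟨mem_symmetricChains.2 hz, funext hb⟩
    rw [← h] at this
    obtain ⟨f, hf, rfl⟩ := this
    refine ⟨f, fun d => ?_, fun d => rfl⟩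
    rw [symmetrize_apply, ← add_assoc, CharTwo.add_self_eq_zero, zero_add]
    simpa using R.mem_faceChains.1 hf d.symm
  · intro h
    refine le_antisymm R.map_symmetrize_faceChains_le ?_
    rintro z ⟨hz, hb⟩
    have hz' := mem_symmetricChains.1 hz
    obtain ⟨f, hf1, hf2⟩ := h z hz' fun p => congrFun hb p
    refine ⟨f, R.mem_faceChains.2 fun d => ?_, funext hf2⟩
    rw [hf1, hz', ← hf2 d, add_comm (f d), ← add_assoc, CharTwo.add_self_eq_zero, zero_add]

end RotationSystem

end Homology

/-! ### First returns, and positions around a vertex of degree 6. -/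

/-- The first-return map of a permutation to the range of an injective function. -/
theorem exists_firstReturn {X Y : Type*} [Finite X] (σ : Equiv.Perm X) (ι : Y → X)
    (hι : Function.Injective ι) : ∃ τ : Equiv.Perm Y,
      (∀ y, ∃ n, ι (τ y) = (σ ^ (n + 1)) (ι y) ∧
        ∀ m < n, (σ ^ (m + 1)) (ι y) ∉ Set.range ι) ∧
      ∀ y y', σ.SameCycle (ι y) (ι y') → τ.SameCycle y y' := by
  classical
  have hex : ∀ y, ∃ n, (σ ^ (n + 1)) (ι y) ∈ Set.range ι := fun y =>
    ⟨orderOf σ - 1, by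
      rw [Nat.sub_add_cancel (isOfFinOrder_of_finite σ).orderOf_pos, pow_orderOf_eq_one]
      exact ⟨y, rfl⟩⟩
  choose r hr using fun y => Nat.find_spec (hex y)
  have hmin : ∀ y, ∀ m < Nat.find (hex y), (σ ^ (m + 1)) (ι y) ∉ Set.range ι :=
    fun y m hm => Nat.find_min (hex y) hm
  have hinj : Function.Injective r := by
    -- If two points return to the same place at different times, the slower one passes through the
    -- faster one, against minimality of its return time.
    have key : ∀ y y', r y = r y' → Nat.find (hex y) ≤ Nat.find (hex y') → y = y' := by
      intro y y' h hle
      have h1 : (σ ^ (Nat.find (hex y) + 1)) (ι y) =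
          (σ ^ (Nat.find (hex y) + 1)) ((σ ^ (Nat.find (hex y') - Nat.find (hex y))) (ι y')) := by
        rw [← Equiv.Perm.mul_apply, ← pow_add, ← hr, h, hr]
        congr 2
        omega
      have h2 := (σ ^ (Nat.find (hex y) + 1)).injective h1
      obtain h3 | h3 := Nat.eq_zero_or_pos (Nat.find (hex y') - Nat.find (hex y))
      · rw [h3] at h2
        exact hι h2
      · refine absurd ⟨y, ?_⟩ (hmin y' (Nat.find (hex y') - Nat.find (hex y) - 1) (by omega))
        exact h2.trans (by rw [Nat.sub_add_cancel h3])
    intro y y' h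
    obtain hle | hle := le_total (Nat.find (hex y)) (Nat.find (hex y'))
    · exact key y y' h hle
    · exact (key y' y h.symm hle).symm
  have : Finite Y := Finite.of_injective ι hι
  refine ⟨Equiv.ofBijective r (Finite.injective_iff_bijective.1 hinj), fun y => ⟨_, hr y, hmin y⟩,
    ?_⟩
  have key : ∀ n y y', ι y' = (σ ^ n) (ι y) →
      Equiv.Perm.SameCycle (Equiv.ofBijective r (Finite.injective_iff_bijective.1 hinj) :
        Equiv.Perm Y) y y' := by
    intro n
    induction n using Nat.strong_induction_on with | _ n ih
    intro y y' h
    obtain rfl | hn := Nat.eq_zero_or_pos n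
    · rw [hι h]
    · have hle : Nat.find (hex y) + 1 ≤ n := by
        by_contra hlt
        refine hmin y (n - 1) (by omega) ⟨y', ?_⟩
        rw [h, Nat.sub_add_cancel hn]
      refine Equiv.Perm.sameCycle_apply_left.1 (ih (n - (Nat.find (hex y) + 1)) (by omega) _ _ ?_)
      change ι y' = (σ ^ (n - (Nat.find (hex y) + 1))) (ι (r y))
      rw [hr, ← Equiv.Perm.mul_apply, ← pow_add, h]
      congr 2
      omega
  intro y y' h
  obtain ⟨n, hn⟩ := h.exists_nat_pow_eq
  exact key n y y' hn.symm

/-- Whether the chords `ij` and `kl` of a hexagon cross (value `1`) or not (value `0`). -/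
def cross (i j k l : Fin 6) : ZMod 2 :=
  (if i < k then 1 else 0) + (if j < k then 1 else 0) + (if i < l then 1 else 0) +
    (if j < l then 1 else 0)

/-- The sum of the values at the positions before `k`. -/
def sumBefore (a : Fin 6 → ZMod 2) (k : Fin 6) : ZMod 2 :=
  ∑ m, if m < k then a m else 0

section Hub

variable {V : Type*} {G : SimpleGraph V}

/-- An enumeration, in cyclic order, of the darts leaving a vertex of degree `6`. -/
structure RotationSystem.Hub (R : RotationSystem G) (u : V) where
  /-- The dart at a given position. -/
  dart : Fin 6 → G.Dart
  dart_fst : ∀ i, (dart i).fst = u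
  next_dart : ∀ i, R.next (dart i) = dart (i + 1)
  injective : Function.Injective dart
  surjective : ∀ d : G.Dart, d.fst = u → ∃ i, dart i = d

theorem RotationSystem.exists_hub [Fintype V] [DecidableEq V] [DecidableRel G.Adj]
    (R : RotationSystem G) {u : V} (hu : G.degree u = 6) : Nonempty (R.Hub u) := by
  set s : Finset G.Dart := {d | d.fst = u} with hs
  have hcard : s.card = 6 := by rw [hs, G.dart_fst_fiber_card_eq_degree, hu]
  have hcyc : R.next.IsCycleOn s := by
    refine ⟨⟨?_, R.next.injective.injOn, ?_⟩, ?_⟩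
    · intro d hd
      simpa [hs, R.next_fst] using hd
    · intro d hd
      refine ⟨R.next.symm d, ?_, by simp⟩
      have := R.next_fst (R.next.symm d)
      rw [Equiv.apply_symm_apply] at this
      simpa [hs, ← this] using hd
    · intro d hd e he
      refine R.sameCycle d e ?_
      simp only [hs, Finset.coe_filter, Finset.mem_univ, true_and, Set.mem_ofPred_eq] at hd he
      rw [hd, he]
  obtain ⟨d₀, hd₀⟩ : s.Nonempty := Finset.card_pos.1 (by omega)
  have hmod : ∀ n, (R.next ^ (n % 6)) d₀ = (R.next ^ n) d₀ := fun n => by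
    rw [hcyc.pow_apply_eq_pow_apply hd₀, hcard]
    exact Nat.mod_modEq n 6
  refine ⟨⟨fun i => (R.next ^ (i : ℕ)) d₀, fun i => ?_, fun i => ?_, fun i j h => ?_,
    fun d hd => ?_⟩⟩
  · have : (R.next ^ (i : ℕ)) d₀ ∈ s := (hcyc.1.perm_pow _).mapsTo hd₀
    simpa [hs] using this
  · rw [← Equiv.Perm.mul_apply, ← pow_succ', Fin.val_add]
    exact (hmod _).symm
  · have := (hcyc.pow_apply_eq_pow_apply hd₀).1 h
    rw [hcard, Nat.ModEq, Nat.mod_eq_of_lt i.2, Nat.mod_eq_of_lt j.2] at this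
    exact Fin.ext this
  · obtain ⟨n, hn, h⟩ := hcyc.exists_pow_eq hd₀ (show d ∈ s by simpa [hs] using hd)
    exact ⟨⟨n, hcard ▸ hn⟩, h⟩

namespace RotationSystem.Hub

variable {R : RotationSystem G} {u : V} (H : R.Hub u)

theorem snd_injective : Function.Injective fun i => (H.dart i).snd := by
  intro i j h
  exact H.injective (SimpleGraph.Dart.ext _ _ (Prod.ext ((H.dart_fst i).trans (H.dart_fst j).symm) h))

theorem adj (i : Fin 6) : G.Adj u (H.dart i).snd := by
  have := (H.dart i).adj
  rwa [H.dart_fst] at this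

theorem add_eq_sumBefore {f z : G.Dart → ZMod 2} (h : ∀ d, f (R.next d) = f d + z d)
    (k l : Fin 6) : f (H.dart k) + f (H.dart l) =
      sumBefore (fun m => z (H.dart m)) k + sumBefore (fun m => z (H.dart m)) l := by
  have key : ∀ k, f (H.dart k) = f (H.dart 0) + sumBefore (fun m => z (H.dart m)) k := by
    intro k
    have h0 : f (H.dart 1) = _ := H.next_dart 0 ▸ h (H.dart 0)
    have h1 : f (H.dart 2) = _ := H.next_dart 1 ▸ h (H.dart 1)
    have h2 : f (H.dart 3) = _ := H.next_dart 2 ▸ h (H.dart 2)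
    have h3 : f (H.dart 4) = _ := H.next_dart 3 ▸ h (H.dart 3)
    have h4 : f (H.dart 5) = _ := H.next_dart 4 ▸ h (H.dart 4)
    unfold sumBefore
    fin_cases k <;> simp [Fin.sum_univ_six] <;> grind
  rw [key k, key l]
  linear_combination CharTwo.add_self_eq_zero (f (H.dart 0))

end RotationSystem.Hub

end Hub

theorem sumBefore_add (a b : Fin 6 → ZMod 2) (k : Fin 6) :
    sumBefore (a + b) k = sumBefore a k + sumBefore b k := by
  unfold sumBefore
  rw [← Finset.sum_add_distrib]
  exact Finset.sum_congr rfl fun m _ => by split_ifs <;> simp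

theorem sumBefore_single (c : ZMod 2) (i k : Fin 6) :
    sumBefore (Pi.single i c) k = if i < k then c else 0 := by
  unfold sumBefore
  rw [Finset.sum_eq_single i]
  · simp
  · intro m _ hm
    simp [hm]
  · simp

theorem cross_comm : ∀ {i j k l : Fin 6}, i ≠ k → i ≠ l → j ≠ k → j ≠ l →
    cross k l i j = cross i j k l := by
  decide +kernel

/-- The comparisons in `cross` are strict, so a step from `i` to `j` passes just one of the two
darts at the ends of the chord. A chord therefore separates its own two ends. -/
theorem cross_self : ∀ {i j : Fin 6}, i ≠ j → cross i j i j = 1 := by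
  decide +kernel

/-- A chord of weight `c` through a hub changes the face coloring between positions `a` and `b` by
`c` exactly when it separates them. -/
theorem cross_mul (i j a b : Fin 6) (c : ZMod 2) :
    ((if i < a then c else 0) + (if j < a then c else 0)) +
      ((if i < b then c else 0) + (if j < b then c else 0)) = c * cross i j a b := by
  simp only [cross, mul_add, mul_ite, mul_one, mul_zero]
  ring

/-! ### Replacing a vertex of degree 6 by two noncrossing chords. -/

section Chords

variable {V : Type*} [Fintype V] {G : SimpleGraph V}

/-- The chord `xy` is drawn along the path `x`, `u`, `y`, and `zt` along `z`, `u`, `t`. A cycle of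
the new graph becomes a cycle of `G` by this detour, it bounds in `G`, and the face coloring is
pulled back. Noncrossing makes the jump across each chord correct. -/
theorem nonOverlapping_of_cross {R : RotationSystem G} (hR : R.IsPlane) {u : V} (H : R.Hub u)
    {i j k l : Fin 6} (hnd : [i, j, k, l].Nodup) (hc : cross i j k l = 0)
    (x y z t : ({u}ᶜ : Set V)) (hx : (H.dart i).snd = x) (hy : (H.dart j).snd = y)
    (hz : (H.dart k).snd = z) (ht : (H.dart l).snd = t) (hxy : ¬ G.Adj x y) (hzt : ¬ G.Adj z t) :
    NonOverlapping G u x y z t := by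
  classical
  have hne : ∀ {a b : Fin 6} {p q : ({u}ᶜ : Set V)}, a ≠ b → (H.dart a).snd = p →
      (H.dart b).snd = q → p ≠ q := by
    rintro a b p q hab hp hq rfl
    exact hab (H.snd_injective (hp.trans hq.symm))
  simp only [List.nodup_cons, List.mem_cons, List.not_mem_nil, or_false, not_or,
    List.nodup_nil, not_false_eq_true, and_true] at hnd
  obtain ⟨⟨hij, hik, hil⟩, ⟨hjk, hjl⟩, hkl⟩ := hnd
  have nxy := hne hij hx hy
  have nxz := hne hik hx hz
  have nxt := hne hil hx ht
  have nyz := hne hjk hy hz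
  have nyt := hne hjl hy ht
  have nzt := hne hkl hz ht
  unfold NonOverlapping
  set K := G.induce ({u}ᶜ : Set V) ⊔ SimpleGraph.edge x y ⊔ SimpleGraph.edge z t
  have hKadj : ∀ a b, K.Adj a b ↔ (G.Adj a b ∨ (SimpleGraph.edge x y).Adj a b) ∨
      (SimpleGraph.edge z t).Adj a b := fun a b => Iff.rfl
  clear_value K
  let exy : K.Dart := ⟨(x, y), by simp [hKadj, SimpleGraph.edge_adj, nxy]⟩
  let ezt : K.Dart := ⟨(z, t), by simp [hKadj, SimpleGraph.edge_adj, nzt]⟩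
  have hcases : ∀ e : K.Dart, ¬ G.Adj e.fst e.snd →
      e = exy ∨ e = exy.symm ∨ e = ezt ∨ e = ezt.symm := by
    rintro ⟨⟨a, b⟩, hab⟩ h
    simp only [hKadj, SimpleGraph.edge_adj] at hab
    change ¬ G.Adj a b at h
    obtain (h1 | ⟨⟨rfl, rfl⟩ | ⟨rfl, rfl⟩, -⟩) | ⟨⟨rfl, rfl⟩ | ⟨rfl, rfl⟩, -⟩ := hab
    · exact absurd h1 h
    · exact Or.inl rfl
    · exact Or.inr (Or.inl rfl)
    · exact Or.inr (Or.inr (Or.inl rfl))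
    · exact Or.inr (Or.inr (Or.inr rfl))
  have hadj : ∀ e : K.Dart, ¬ G.Adj e.fst e.snd → G.Adj e.fst u := by
    intro e he
    obtain rfl | rfl | rfl | rfl := hcases e he
    · exact hx ▸ (H.adj i).symm
    · exact hy ▸ (H.adj j).symm
    · exact hz ▸ (H.adj k).symm
    · exact ht ▸ (H.adj l).symm
  -- A chord leaves its end in the direction of the old edge to `u`. The four ends are distinct and
  -- the chords are new, so no two darts of `K` collide.
  let ι : K.Dart → G.Dart := fun e =>
    if h : G.Adj e.fst e.snd then ⟨(e.fst, e.snd), h⟩ else ⟨(e.fst, u), hadj e h⟩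
  have ιfst : ∀ e, (ι e).fst = e.fst := fun e => by
    by_cases h : G.Adj e.fst e.snd <;> simp [ι, h]
  have ιsnd : ∀ e, G.Adj e.fst e.snd → (ι e).snd = e.snd := fun e h => by simp [ι, h]
  have ιsnd' : ∀ e, ¬ G.Adj e.fst e.snd → (ι e).snd = u := fun e h => by simp [ι, h]
  have hinj : Function.Injective ι := by
    intro e e' h
    have h1 : e.fst = e'.fst := Subtype.ext (by rw [← ιfst, ← ιfst, h])
    by_cases he : G.Adj e.fst e.snd
    · by_cases he' : G.Adj e'.fst e'.snd
      · exact SimpleGraph.Dart.ext _ _ (Prod.ext h1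
          (Subtype.ext (by rw [← ιsnd e he, ← ιsnd e' he', h])))
      · refine absurd ?_ e.snd.2
        rw [← ιsnd e he, h, ιsnd' e' he']
        rfl
    · by_cases he' : G.Adj e'.fst e'.snd
      · refine absurd ?_ e'.snd.2
        rw [← ιsnd e' he', ← h, ιsnd' e he]
        rfl
      · obtain rfl | rfl | rfl | rfl := hcases e he <;>
        obtain rfl | rfl | rfl | rfl := hcases e' he' <;>
        first
        | rfl
        | exact absurd h1 (by assumption)
        | exact absurd h1.symm (by assumption)
  have hfstne : ∀ e : K.Dart, (e.fst : V) ≠ u := fun e => e.fst.2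
  obtain ⟨τ, hτ, hcyc⟩ := exists_firstReturn R.next ι hinj
  have hpow : ∀ n d, ((R.next ^ n) d).fst = d.fst := by
    intro n d
    induction n with
    | zero => rfl
    | succ n ih => rw [pow_succ', Equiv.Perm.mul_apply, R.next_fst, ih]
  let R' : RotationSystem K :=
    { next := τ
      next_fst := fun d => by
        obtain ⟨n, hn, -⟩ := hτ d
        refine Subtype.ext ?_
        rw [← ιfst, hn, hpow, ιfst]
      sameCycle := fun d e h => hcyc d e (R.sameCycle _ _ (by rw [ιfst, ιfst, h])) }
  refine ⟨R', R'.isPlane_iff.2 fun z' hz' hb' => ?_⟩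
  have ιxy : ι exy = (H.dart i).symm := by
    refine SimpleGraph.Dart.ext _ _ (Prod.ext ?_ ?_)
    · rw [ιfst]
      exact hx.symm
    · rw [ιsnd' exy hxy]
      exact (H.dart_fst i).symm
  have ιyx : ι exy.symm = (H.dart j).symm := by
    refine SimpleGraph.Dart.ext _ _ (Prod.ext ?_ ?_)
    · rw [ιfst]
      exact hy.symm
    · rw [ιsnd' exy.symm fun h => hxy h.symm]
      exact (H.dart_fst j).symm
  have ιzt : ι ezt = (H.dart k).symm := by
    refine SimpleGraph.Dart.ext _ _ (Prod.ext ?_ ?_)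
    · rw [ιfst]
      exact hz.symm
    · rw [ιsnd' ezt hzt]
      exact (H.dart_fst k).symm
  have ιtz : ι ezt.symm = (H.dart l).symm := by
    refine SimpleGraph.Dart.ext _ _ (Prod.ext ?_ ?_)
    · rw [ιfst]
      exact ht.symm
    · rw [ιsnd' ezt.symm fun h => hzt h.symm]
      exact (H.dart_fst l).symm
  have ιsymm : ∀ e, G.Adj e.fst e.snd → ι e.symm = (ι e).symm := by
    intro e he
    refine SimpleGraph.Dart.ext _ _ (Prod.ext ?_ ?_)
    · rw [ιfst]
      exact (ιsnd e he).symm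
    · rw [ιsnd e.symm he.symm]
      exact (ιfst e).symm
  -- the chain in `G` that detours through `u`
  let ζ : G.Dart → ZMod 2 := fun d =>
    if h : ∃ e, ι e = d then z' h.choose else if h : ∃ e, ι e = d.symm then z' h.choose else 0
  have ζι : ∀ e, ζ (ι e) = z' e := by
    intro e
    have h : ∃ e', ι e' = ι e := ⟨e, rfl⟩
    simp only [ζ, dif_pos h]
    rw [hinj h.choose_spec]
  have ζι' : ∀ e, ζ (ι e).symm = z' e := by
    intro e
    by_cases he : G.Adj e.fst e.snd
    · rw [← ιsymm e he, ζι, hz']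
    · have h1 : ¬ ∃ e', ι e' = (ι e).symm := by
        rintro ⟨e', h⟩
        refine hfstne e' ?_
        rw [← ιfst, h]
        exact ιsnd' e he
      have h2 : ∃ e', ι e' = (ι e).symm.symm := ⟨e, rfl⟩
      simp only [ζ, dif_neg h1, dif_pos h2]
      rw [hinj h2.choose_spec]
  have ζ0 : ∀ d, d ∉ Set.range ι → d.symm ∉ Set.range ι → ζ d = 0 := by
    intro d h1 h2
    simp only [ζ, dif_neg (show ¬ ∃ e, ι e = d from h1),
      dif_neg (show ¬ ∃ e, ι e = d.symm from h2)]
  have ζsymm : ∀ d, ζ d.symm = ζ d := by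
    intro d
    by_cases h1 : d ∈ Set.range ι
    · obtain ⟨e, rfl⟩ := h1
      rw [ζι, ζι']
    · by_cases h2 : d.symm ∈ Set.range ι
      · obtain ⟨e, he⟩ := h2
        rw [← he, ζι, ← ζι' e, he, SimpleGraph.Dart.symm_symm]
      · rw [ζ0 d h1 h2, ζ0 _ h2 (by rwa [SimpleGraph.Dart.symm_symm])]
  have ζoff : ∀ d : G.Dart, d.fst ≠ u → d ∉ Set.range ι → ζ d = 0 := by
    intro d hd h1
    refine ζ0 d h1 ?_
    rintro ⟨e, he⟩
    by_cases h : G.Adj e.fst e.snd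
    · exact h1 ⟨e.symm, by rw [ιsymm e h, he, SimpleGraph.Dart.symm_symm]⟩
    · refine hd ?_
      rw [← ιsnd' e h, he]
      rfl
  have ζb : ∀ p, p ≠ u → boundary G ζ p = 0 := by
    intro p hp
    rw [← hb' ⟨p, hp⟩, boundary_apply, boundary_apply]
    symm
    refine Fintype.sum_of_injective (M := ZMod 2) ι hinj _ _ ?_ ?_
    · intro d hd
      exact ite_eq_right_iff.2 fun h => ζoff d (h ▸ hp) hd
    · intro e
      simp only [ζι, ιfst]
      simp [Subtype.ext_iff]
  have ζb' : ∀ p, boundary G ζ p = 0 := by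
    intro p
    by_cases hp : p = u
    · subst hp
      have h1 : ∑ q, boundary G ζ q = boundary G ζ p :=
        Finset.sum_eq_single p (fun q _ hq => ζb q hq) (by simp)
      rw [← h1]
      simp only [boundary_apply]
      rw [Finset.sum_comm]
      simpa using sum_eq_zero_of_symm (fun _ => True) ζsymm (by simp)
    · exact ζb p hp
  obtain ⟨f, hf1, hf2⟩ := R.isPlane_iff.1 hR ζ ζsymm ζb'
  have hsum : ∀ a b, f (H.dart a) + f (H.dart b) =
      ((if i < a then z' exy else 0) + (if j < a then z' exy else 0) +
        ((if k < a then z' ezt else 0) + (if l < a then z' ezt else 0))) +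
      ((if i < b then z' exy else 0) + (if j < b then z' exy else 0) +
        ((if k < b then z' ezt else 0) + (if l < b then z' ezt else 0))) := by
    intro a b
    have hζ : (fun m => ζ (H.dart m)) = (Pi.single i (z' exy) + Pi.single j (z' exy)) +
        (Pi.single k (z' ezt) + Pi.single l (z' ezt)) := by
      ext m
      by_cases hmi : m = i
      · subst hmi
        rw [← ζsymm, ← ιxy, ζι]
        simp [hij, hik, hil]
      by_cases hmj : m = j
      · subst hmj
        rw [← ζsymm, ← ιyx, ζι, hz']
        simp [Ne.symm hij, hjk, hjl]
      by_cases hmk : m = k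
      · subst hmk
        rw [← ζsymm, ← ιzt, ζι]
        simp [Ne.symm hik, Ne.symm hjk, hkl]
      by_cases hml : m = l
      · subst hml
        rw [← ζsymm, ← ιtz, ζι, hz']
        simp [Ne.symm hil, Ne.symm hjl, Ne.symm hkl]
      simp only [Pi.add_apply, Pi.single_apply, hmi, hmj, hmk, hml, if_false, add_zero]
      refine ζ0 _ ?_ ?_
      · rintro ⟨e, he⟩
        exact hfstne e (by rw [← ιfst, he, H.dart_fst])
      · rintro ⟨e, he⟩
        have hn : ¬ G.Adj e.fst e.snd := by
          intro h
          refine e.snd.2 ?_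
          rw [Set.mem_singleton_iff, ← ιsnd e h, he]
          exact H.dart_fst m
        have hd : ∀ {a}, (H.dart m).symm = (H.dart a).symm → m = a := fun h =>
          H.injective (SimpleGraph.Dart.symm_involutive.injective h)
        obtain rfl | rfl | rfl | rfl := hcases e hn
        · exact hmi (hd (he.symm.trans ιxy))
        · exact hmj (hd (he.symm.trans ιyx))
        · exact hmk (hd (he.symm.trans ιzt))
        · exact hml (hd (he.symm.trans ιtz))
    rw [H.add_eq_sumBefore hf1, hζ]
    simp only [sumBefore_add, sumBefore_single]
  -- From dart `i` to dart `j`, the chord `xy` itself counts once and the other chord not at all.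
  have hd1 : f (H.dart i) + f (H.dart j) = z' exy := by
    linear_combination hsum i j + cross_mul i j i j (z' exy) + cross_mul k l i j (z' ezt) +
      z' exy * cross_self hij + z' ezt * cross_comm hik hil hjk hjl + z' ezt * hc
  have hd2 : f (H.dart k) + f (H.dart l) = z' ezt := by
    linear_combination hsum k l + cross_mul i j k l (z' exy) + cross_mul k l k l (z' ezt) +
      z' ezt * cross_self hkl + z' exy * hc
  have hflip : ∀ d : G.Dart, f d.symm = f d + ζ d := by
    intro d
    linear_combination hf2 d - CharTwo.add_self_eq_zero (f d)
  have ζi : ζ (H.dart i) = z' exy := by rw [← ζsymm, ← ιxy, ζι]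
  have ζj : ζ (H.dart j) = z' exy := by rw [← ζsymm, ← ιyx, ζι, hz']
  have ζk : ζ (H.dart k) = z' ezt := by rw [← ζsymm, ← ιzt, ζι]
  have ζl : ζ (H.dart l) = z' ezt := by rw [← ζsymm, ← ιtz, ζι, hz']
  have hxy' : f (ι exy) + f (ι exy.symm) = z' exy := by
    rw [ιxy, ιyx, hflip, hflip, ζi, ζj]
    linear_combination hd1 + CharTwo.add_self_eq_zero (z' exy)
  have hzt' : f (ι ezt) + f (ι ezt.symm) = z' ezt := by
    rw [ιzt, ιtz, hflip, hflip, ζk, ζl]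
    linear_combination hd2 + CharTwo.add_self_eq_zero (z' ezt)
  refine ⟨fun e => f (ι e), fun e => ?_, fun e => ?_⟩
  · obtain ⟨n, hn, hmin⟩ := hτ e
    change f (ι (τ e)) = _
    rw [hn]
    -- The darts skipped by the first return carry no weight, so `f` changes only at the initial
    -- dart.
    have : ∀ m ≤ n, f ((R.next ^ (m + 1)) (ι e)) = f (ι e) + z' e := by
      intro m hm
      induction m with
      | zero => rw [zero_add, pow_one, hf1, ζι]
      | succ m ih =>
        rw [pow_succ', Equiv.Perm.mul_apply, hf1, ih (by omega), ζoff, add_zero]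
        · rw [hpow, ιfst]
          exact hfstne e
        · exact hmin m (by omega)
    exact this n le_rfl
  · change f (ι e) + f (ι e.symm) = z' e
    by_cases he : G.Adj e.fst e.snd
    · rw [ιsymm e he, hf2, ζι]
    · obtain rfl | rfl | rfl | rfl := hcases e he
      · exact hxy'
      · rw [hz', ← hxy', add_comm, SimpleGraph.Dart.symm_symm]
      · exact hzt'
      · rw [hz', ← hzt', add_comm, SimpleGraph.Dart.symm_symm]

end Chords

/-! ### Sequences of Kempe changes. -/

section Recoloring

variable {V : Type*} {G : SimpleGraph V} {k : ℕ}

/-- `ψ` arises from `φ` by Kempe changes that never involve the color `α` and that change the color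
of each vertex `w` exactly `t w` times. -/
inductive Recolors (α : Fin k) : G.Coloring (Fin k) → G.Coloring (Fin k) → (V → ℕ) → Prop
  | refl (φ : G.Coloring (Fin k)) : Recolors α φ φ 0
  | step {φ φ' ψ : G.Coloring (Fin k)} {t : V → ℕ} (h : KempeChange φ φ')
      (h' : ∀ w, φ' w ≠ φ w → φ w ≠ α ∧ φ' w ≠ α) (h'' : Recolors α φ' ψ t) :
      Recolors α φ ψ (t + fun w => if φ' w = φ w then 0 else 1)

theorem Recolors.trans {α : Fin k} {φ ψ χ : G.Coloring (Fin k)} {t t' : V → ℕ}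
    (h : Recolors α φ ψ t) (h' : Recolors α ψ χ t') : Recolors α φ χ (t + t') := by
  induction h with
  | refl => rwa [zero_add]
  | step h1 h2 _ ih =>
    rw [add_right_comm]
    exact .step h1 h2 (ih h')

theorem Recolors.apply_eq {α : Fin k} {φ ψ : G.Coloring (Fin k)} {t : V → ℕ}
    (h : Recolors α φ ψ t) {w : V} (hw : φ w = α) : ψ w = α := by
  induction h with
  | refl => exact hw
  | step h1 h2 _ ih =>
    refine ih ?_
    by_contra h3
    exact (h2 w fun h4 => h3 (h4.trans hw)).1 hw

theorem Recolors.exists_sequence {α : Fin k} {φ ψ : G.Coloring (Fin k)} {t : V → ℕ}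
    (h : Recolors α φ ψ t) : ∃ (m : ℕ) (c : ℕ → G.Coloring (Fin k)), c 0 = φ ∧ c m = ψ ∧
      (∀ i < m, KempeChange (c i) (c (i + 1))) ∧
      (∀ i < m, ∀ w, c (i + 1) w ≠ c i w → c (i + 1) w ≠ α) ∧
      (∀ i ≤ m, ∀ w, φ w = α → c i w = α) ∧
      ∀ w, ((Finset.range m).filter fun i => c (i + 1) w ≠ c i w).card = t w := by
  induction h with
  | refl φ =>
    refine ⟨0, fun _ => φ, rfl, rfl, ?_, ?_, ?_, ?_⟩
    · simp
    · simp
    · exact fun _ _ _ h => h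
    · simp
  | @step φ φ' ψ t h1 h2 _ ih =>
    obtain ⟨m, c, h0, hm, hk, hα, hf, hcard⟩ := ih
    -- The old coloring is put in front of the sequence, shifting the rest by one.
    refine ⟨m + 1, fun i => Nat.casesOn i φ c, rfl, hm, ?_, ?_, ?_, ?_⟩
    · rintro (_ | i) hi
      · change KempeChange φ (c 0)
        rwa [h0]
      · exact hk i (by omega)
    · rintro (_ | i) hi
      · change ∀ w, c 0 w ≠ φ w → c 0 w ≠ α
        rw [h0]
        exact fun w hw => (h2 w hw).2
      · exact hα i (by omega)
    · rintro (_ | i) hi w hw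
      · exact hw
      · refine hf i (by omega) w ?_
        by_contra h3
        exact (h2 w fun h4 => h3 (h4.trans hw)).1 hw
    · intro w
      simp only [Finset.card_filter] at hcard ⊢
      rw [Finset.sum_range_succ', hcard]
      simp only [Pi.add_apply]
      congr 1
      change (if c 0 w ≠ φ w then 1 else 0) = _
      rw [h0]
      split_ifs <;> simp_all

theorem exists_kempeChain (φ : G.Coloring (Fin k)) {p q : Fin k} {x : V}
    (hx : φ x = p ∨ φ x = q) : IsKempeChain φ p q
      {y | Relation.ReflTransGen (fun a b => G.Adj a b ∧ (φ b = p ∨ φ b = q)) x y} := by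
  set B : Set V := {y | Relation.ReflTransGen (fun a b => G.Adj a b ∧ (φ b = p ∨ φ b = q)) x y}
    with hB
  have hxB : x ∈ B := Relation.ReflTransGen.refl
  refine ⟨⟨(SimpleGraph.connected_iff_exists_forall_reachable _).2 ⟨⟨x, hxB⟩, ?_⟩, ?_⟩, ?_⟩
  · rintro ⟨y, hy⟩
    have key : ∀ y, Relation.ReflTransGen (fun a b => G.Adj a b ∧ (φ b = p ∨ φ b = q)) x y →
        ∃ hy : y ∈ B, (G.induce B).Reachable ⟨x, hxB⟩ ⟨y, hy⟩ := by
      intro y h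
      induction h with
      | refl => exact ⟨hxB, .refl _⟩
      | tail h1 h2 ih =>
        obtain ⟨hb, h3⟩ := ih
        refine ⟨h1.tail h2, h3.trans (SimpleGraph.Adj.reachable ?_)⟩
        exact h2.1
    exact (key y hy).2
  · intro y hy
    obtain rfl | ⟨z, -, h⟩ := Relation.ReflTransGen.cases_tail hy
    · exact hx
    · exact h.2
  · rintro T ⟨hT, hTc⟩ hBT y hy
    obtain ⟨w⟩ := hT.preconnected ⟨x, hBT hxB⟩ ⟨y, hy⟩
    have key : ∀ (a b : T), (G.induce T).Walk a b → (a : V) ∈ B → (b : V) ∈ B := by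
      intro a b w
      induction w with
      | nil => exact id
      | @cons a b c hab _ ih =>
        exact fun ha => ih (Relation.ReflTransGen.tail ha ⟨hab, hTc _ b.2⟩)
    exact key _ _ w hxB

/-- Such a set `S` is a disjoint union of Kempe chains. Swapping one leaves the others chains, so
they can be swapped one by one and each vertex changes at most once. -/
theorem Recolors.exists_swap [Finite V] {α p q : Fin k} (hpq : p ≠ q) (hp : p ≠ α) (hq : q ≠ α)
    (φ : G.Coloring (Fin k)) (S : Set V) (hS : ∀ x ∈ S, φ x = p ∨ φ x = q)
    (hcl : ∀ x ∈ S, ∀ y, G.Adj x y → (φ y = p ∨ φ y = q) → y ∈ S) :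
    ∃ (ψ : G.Coloring (Fin k)) (t : V → ℕ), Recolors α φ ψ t ∧
      (∀ x ∈ S, ψ x = Equiv.swap p q (φ x) ∧ t x ≤ 1) ∧ ∀ x ∉ S, ψ x = φ x ∧ t x = 0 := by
  classical
  have hsw : ∀ a : Fin k, Equiv.swap p q a = p ∨ Equiv.swap p q a = q ↔ a = p ∨ a = q := by
    intro a
    rw [Equiv.swap_apply_eq_iff, Equiv.swap_apply_left, Equiv.swap_apply_eq_iff,
      Equiv.swap_apply_right, or_comm]
  induction hn : S.ncard using Nat.strong_induction_on generalizing φ S with | _ n ih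
  obtain rfl | ⟨x, hx⟩ := S.eq_empty_or_nonempty
  · exact ⟨φ, 0, .refl φ, by simp, by simp⟩
  set B : Set V := {y | Relation.ReflTransGen (fun a b => G.Adj a b ∧ (φ b = p ∨ φ b = q)) x y}
    with hB
  have hxB : x ∈ B := Relation.ReflTransGen.refl
  have hchain : IsKempeChain φ p q B := exists_kempeChain φ (hS x hx)
  have hBS : B ⊆ S := by
    intro y hy
    induction hy with
    | refl => exact hx
    | tail h1 h2 ih => exact hcl _ ih _ h2.1 h2.2
  have hBcl : ∀ a ∈ B, ∀ b, G.Adj a b → (φ b = p ∨ φ b = q) → b ∈ B := fun a ha b hab hb =>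
    Relation.ReflTransGen.tail ha ⟨hab, hb⟩
  have hmixed : ∀ a b, G.Adj a b → a ∈ B → b ∉ B → Equiv.swap p q (φ a) ≠ φ b := by
    intro a b hab ha hb h
    refine hb (hBcl a ha b hab ?_)
    rw [← h, hsw]
    exact hS a (hBS ha)
  let φ' : G.Coloring (Fin k) := SimpleGraph.Coloring.mk
    (fun y => if y ∈ B then Equiv.swap p q (φ y) else φ y) (by
      intro a b hab
      split_ifs with ha hb hb
      · exact fun h => φ.valid hab ((Equiv.swap p q).injective h)
      · exact hmixed a b hab ha hb
      · exact (hmixed b a hab.symm hb ha).symm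
      · exact φ.valid hab)
  have hin : ∀ y ∈ B, φ' y = Equiv.swap p q (φ y) := fun y hy => if_pos hy
  have hout : ∀ y ∉ B, φ' y = φ y := fun y hy => if_neg hy
  have hcol : ∀ y, (φ' y = p ∨ φ' y = q) ↔ (φ y = p ∨ φ y = q) := by
    intro y
    by_cases hy : y ∈ B
    · rw [hin y hy, hsw]
    · rw [hout y hy]
  obtain ⟨ψ, t, ht, h1, h2⟩ := ih (S \ B).ncard
    (hn ▸ Set.ncard_lt_ncard ⟨Set.sdiff_subset, fun h => (h hx).2 hxB⟩) φ' (S \ B)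
    (fun y hy => (hcol y).2 (hS y hy.1))
    (fun y hy z hyz hz => ⟨hcl y hy.1 z hyz ((hcol z).1 hz), fun hzB => hy.2
      (hBcl z hzB y hyz.symm (hS y hy.1))⟩) rfl
  refine ⟨ψ, _, .step ⟨p, q, B, hpq, hchain, hin, hout⟩ ?_ ht, ?_, ?_⟩
  · intro w hw
    by_cases hwB : w ∈ B
    · have h3 := hS w (hBS hwB)
      have h4 := (hcol w).2 h3
      constructor
      · obtain h | h := h3 <;> rwa [h]
      · obtain h | h := h4 <;> rwa [h]
    · exact absurd (hout w hwB) hw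
  · intro y hy
    by_cases hyB : y ∈ B
    · obtain ⟨h3, h4⟩ := h2 y fun h => h.2 hyB
      refine ⟨h3.trans (hin y hyB), ?_⟩
      simp only [Pi.add_apply, h4]
      split_ifs <;> simp
    · obtain ⟨h3, h4⟩ := h1 y ⟨hy, hyB⟩
      rw [hout y hyB] at h3
      exact ⟨h3, by simpa [hout y hyB] using h4⟩
  · intro y hy
    have hyB : y ∉ B := fun h => hy (hBS h)
    obtain ⟨h3, h4⟩ := h2 y fun h => hy h.1
    rw [hout y hyB] at h3
    exact ⟨h3, by simpa [hout y hyB] using h4⟩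

end Recoloring

/-! ### Color patterns on a hexagon and the recoloring game. -/

/-- A color pattern on a hexagon is good if it has three equal colors, or two disjoint chords that
do not cross and each join equal colors. -/
def GoodPattern {κ : Type*} (c : Fin 6 → κ) : Prop :=
  (∃ i j k, i ≠ j ∧ i ≠ k ∧ j ≠ k ∧ c i = c j ∧ c i = c k) ∨
    ∃ i j k l, [i, j, k, l].Nodup ∧ cross i j k l = 0 ∧ c i = c j ∧ c k = c l

/-- The symmetries of the hexagon. -/
def dihedral (s : Bool) (r i : Fin 6) : Fin 6 := bif s then r + i else r - i

theorem dihedral_injective : ∀ s r, Function.Injective (dihedral s r) := by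
  decide +kernel

theorem cross_dihedral : ∀ s r i j k l, i ≠ k → i ≠ l → j ≠ k → j ≠ l →
    cross (dihedral s r i) (dihedral s r j) (dihedral s r k) (dihedral s r l) = cross i j k l := by
  decide +kernel

theorem GoodPattern.of_dihedral {κ : Type*} {c : Fin 6 → κ} {s : Bool} {r : Fin 6}
    (h : GoodPattern (c ∘ dihedral s r)) : GoodPattern c := by
  have hi : ∀ {i j}, i ≠ j → dihedral s r i ≠ dihedral s r j := (dihedral_injective s r).ne
  obtain ⟨i, j, k, hij, hik, hjk, h1, h2⟩ | ⟨i, j, k, l, hnd, hc, h1, h2⟩ := h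
  · exact Or.inl ⟨_, _, _, hi hij, hi hik, hi hjk, h1, h2⟩
  · refine Or.inr ⟨_, _, _, _, hnd.map (dihedral_injective s r), ?_, h1, h2⟩
    simp only [List.nodup_cons, List.mem_cons, List.not_mem_nil, or_false, not_or] at hnd
    rwa [cross_dihedral s r i j k l hnd.1.2.1 hnd.1.2.2 hnd.2.1.1 hnd.2.1.2]

/-- The first two lines of alternatives are good patterns. The other four are the bad types
`bcbcde`, `bdceb` followed by `c`, `bdcbec` and `bcdbcd`, listed cyclically. -/
theorem pattern_cases : ∀ c0 c1 c2 c3 c4 c5 : Fin 4, ∃ s r,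
    let c := fun i => ![c0, c1, c2, c3, c4, c5] (dihedral s r i)
    c 0 = c 1 ∧ (c 0 = c 2 ∨ c 0 = c 3 ∨ c 2 = c 3 ∨ c 2 = c 4 ∨ c 2 = c 5 ∨ c 3 = c 4) ∨
    c 0 = c 2 ∧ (c 0 = c 4 ∨ c 3 = c 5) ∨
    c 0 = c 2 ∧ c 1 = c 3 ∧ [c 0, c 1, c 4, c 5].Nodup ∨
    c 0 = c 4 ∧ c 2 = c 5 ∧ [c 0, c 2, c 1, c 3].Nodup ∨
    c 0 = c 3 ∧ c 2 = c 5 ∧ [c 0, c 2, c 1, c 4].Nodup ∨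
    c 0 = c 3 ∧ c 1 = c 4 ∧ c 2 = c 5 ∧ [c 0, c 1, c 2].Nodup := by
  decide +kernel

/-- The recolorings seen from a vertex of degree `6`: each state colors the six neighbors with
colors other than `α`, the relation `conn s p q` is connection by chains in the colors `p` and `q`,
and a chain may be swapped. Chains in disjoint pairs of colors cannot cross. -/
structure HexGame (α : Fin 5) (X : Type*) where
  /-- The colors of the six neighbors. -/
  col : X → Fin 6 → Fin 5
  /-- Connection by a chain. -/
  conn : X → Fin 5 → Fin 5 → Fin 6 → Fin 6 → Prop
  /-- Possible moves. -/
  Step : X → X → Prop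
  col_ne : ∀ s i, col s i ≠ α
  refl : ∀ s p q i, conn s p q i i
  symm : ∀ s p q i j, conn s p q i j → conn s p q j i
  trans : ∀ s p q i j k, conn s p q i j → conn s p q j k → conn s p q i k
  move : ∀ s p q i, p ≠ q → p ≠ α → q ≠ α → (col s i = p ∨ col s i = q) → ∃ s', Step s s' ∧
    ∀ j, (conn s p q i j → col s' j = Equiv.swap p q (col s j)) ∧
      (¬ conn s p q i j → col s' j = col s j)
  sep : ∀ s p q r t i j k l, [p, q, r, t, α].Nodup →
    (col s i = p ∨ col s i = q) → (col s j = p ∨ col s j = q) →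
    (col s k = r ∨ col s k = t) → (col s l = r ∨ col s l = t) →
    cross i j k l = 1 → conn s p q i j → ¬ conn s r t k l

namespace HexGame

variable {α : Fin 5} {X : Type*} (Γ : HexGame α X)

/-- A good pattern can be reached in at most `n` moves. -/
def Wins : ℕ → X → Prop
  | 0, s => GoodPattern (Γ.col s)
  | n + 1, s => GoodPattern (Γ.col s) ∨ ∃ s', Γ.Step s s' ∧ Wins n s'

variable {Γ}

theorem Wins.of_good {s : X} (h : GoodPattern (Γ.col s)) : ∀ n, Γ.Wins n s
  | 0 => h
  | _ + 1 => Or.inl h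

theorem Wins.succ {s : X} {n : ℕ} (h : Γ.Wins n s) : Γ.Wins (n + 1) s := by
  induction n generalizing s with
  | zero => exact Or.inl h
  | succ n ih => exact h.imp id fun ⟨s', h1, h2⟩ => ⟨s', h1, ih h2⟩

theorem Wins.of_three {s : X} (n : ℕ) (i j k : Fin 6) (hij : i ≠ j) (hik : i ≠ k) (hjk : j ≠ k)
    (h1 : Γ.col s i = Γ.col s j) (h2 : Γ.col s i = Γ.col s k) : Γ.Wins n s :=
  .of_good (Or.inl ⟨i, j, k, hij, hik, hjk, h1, h2⟩) n

theorem Wins.of_two {s : X} (n : ℕ) (i j k l : Fin 6) (hnd : [i, j, k, l].Nodup)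
    (hc : cross i j k l = 0) (h1 : Γ.col s i = Γ.col s j) (h2 : Γ.col s k = Γ.col s l) :
    Γ.Wins n s :=
  .of_good (Or.inr ⟨i, j, k, l, hnd, hc, h1, h2⟩) n

theorem exists_move {s : X} {p q : Fin 5} {i : Fin 6} (hpq : p ≠ q) (hi : Γ.col s i = p)
    (hq : q ≠ α) : ∃ s', Γ.Step s s' ∧ Γ.col s' i = q ∧
      (∀ j, Γ.conn s p q i j → Γ.col s j = p → Γ.col s' j = q) ∧
      (∀ j, Γ.conn s p q i j → Γ.col s j = q → Γ.col s' j = p) ∧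
      (∀ j, ¬ Γ.conn s p q i j → Γ.col s' j = Γ.col s j) ∧
      ∀ j, Γ.col s j ≠ p → Γ.col s j ≠ q → Γ.col s' j = Γ.col s j := by
  obtain ⟨s', h, h'⟩ := Γ.move s p q i hpq (hi ▸ Γ.col_ne s i) hq (Or.inl hi)
  have h1 : ∀ j, Γ.conn s p q i j → Γ.col s j = p → Γ.col s' j = q := fun j hj hc => by
    rw [(h' j).1 hj, hc, Equiv.swap_apply_left]
  refine ⟨s', h, h1 i (Γ.refl _ _ _ _) hi, h1, fun j hj hc => ?_, fun j hj => (h' j).2 hj,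
    fun j hp hq => ?_⟩
  · rw [(h' j).1 hj, hc, Equiv.swap_apply_right]
  · by_cases hj : Γ.conn s p q i j
    · rw [(h' j).1 hj, Equiv.swap_apply_of_ne_of_ne hp hq]
    · exact (h' j).2 hj

/-- A `d`-`b` chain from 4 to 0 cuts 5 off from 1 and 3, so 5 can turn `c` to make three alike.
Otherwise 4 turns `b` while 0 keeps `b`; either 2 joins them, or the chord 04 goes with 13. -/
theorem wins_bcbcde {s : X} {b c d e : Fin 5} (hp : [b, c, d, e, α].Nodup) (h0 : Γ.col s 0 = b)
    (h1 : Γ.col s 1 = c) (h2 : Γ.col s 2 = b) (h3 : Γ.col s 3 = c) (h4 : Γ.col s 4 = d)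
    (h5 : Γ.col s 5 = e) : Γ.Wins 1 s := by
  have hp' := hp
  simp only [List.nodup_cons, List.mem_cons, List.not_mem_nil, or_false, not_or] at hp
  obtain ⟨⟨bc, bd, be, bα⟩, ⟨cd, ce, cα⟩, ⟨de, dα⟩, eα, -⟩ := hp
  by_cases h40 : Γ.conn s d b 4 0
  · have h51 : ¬ Γ.conn s e c 5 1 := Γ.sep s d b e c 4 0 5 1 (by grind)
      (by grind) (by grind) (by grind) (by grind) (by decide) h40
    have h53 : ¬ Γ.conn s e c 5 3 := Γ.sep s d b e c 4 0 5 3 (by grind)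
      (by grind) (by grind) (by grind) (by grind) (by decide) h40
    obtain ⟨s', hs, hm, -, -, hm1, hm2⟩ := exists_move (Ne.symm ce) h5 cα
    exact Or.inr ⟨s', hs, .of_three 0 5 1 3 (by decide) (by decide) (by decide)
      (by grind) (by grind)⟩
  · obtain ⟨s', hs, hm, hm1, hm2, hm3, hm4⟩ := exists_move (Ne.symm bd) h4 bα
    by_cases h42 : Γ.conn s d b 4 2
    · exact Or.inr ⟨s', hs, .of_two 0 1 3 0 4 (by decide) (by decide) (by grind) (by grind)⟩
    · exact Or.inr ⟨s', hs, .of_three 0 4 0 2 (by decide) (by decide) (by decide)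
        (by grind) (by grind)⟩

/-- Either 1 and 3 can be made alike, giving chords 13 and 04, or their chain shields 2, which can
join the color of 0 and 4. The color at 5 is irrelevant. -/
theorem wins_bdceb {s : X} {b c d e : Fin 5} (hp : [b, c, d, e, α].Nodup) (h0 : Γ.col s 0 = b)
    (h1 : Γ.col s 1 = d) (h2 : Γ.col s 2 = c) (h3 : Γ.col s 3 = e) (h4 : Γ.col s 4 = b) :
    Γ.Wins 1 s := by
  have hp' := hp
  simp only [List.nodup_cons, List.mem_cons, List.not_mem_nil, or_false, not_or] at hp
  obtain ⟨⟨bc, bd, be, bα⟩, ⟨cd, ce, cα⟩, ⟨de, dα⟩, eα, -⟩ := hp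
  by_cases h13 : Γ.conn s d e 1 3
  · have h20 : ¬ Γ.conn s c b 2 0 := Γ.sep s d e c b 1 3 2 0 (by grind)
      (by grind) (by grind) (by grind) (by grind) (by decide) h13
    have h24 : ¬ Γ.conn s c b 2 4 := Γ.sep s d e c b 1 3 2 4 (by grind)
      (by grind) (by grind) (by grind) (by grind) (by decide) h13
    obtain ⟨s', hs, hm, -, -, hm1, hm2⟩ := exists_move (Ne.symm bc) h2 bα
    exact Or.inr ⟨s', hs, .of_three 0 2 0 4 (by decide) (by decide) (by decide)
      (by grind) (by grind)⟩
  · obtain ⟨s', hs, hm, -, -, hm1, hm2⟩ := exists_move de h1 eα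
    exact Or.inr ⟨s', hs, .of_two 0 1 3 0 4 (by decide) (by decide) (by grind) (by grind)⟩

variable (Γ) in
/-- The same game after a symmetry of the hexagon. -/
def relabel (a : Bool) (r : Fin 6) : HexGame α X where
  col s i := Γ.col s (dihedral a r i)
  conn s p q i j := Γ.conn s p q (dihedral a r i) (dihedral a r j)
  Step := Γ.Step
  col_ne s _ := Γ.col_ne s _
  refl s p q _ := Γ.refl s p q _
  symm s p q _ _ := Γ.symm s p q _ _
  trans s p q _ _ _ := Γ.trans s p q _ _ _
  move s p q i hpq hp hq hi := by
    obtain ⟨s', h, h'⟩ := Γ.move s p q _ hpq hp hq hi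
    exact ⟨s', h, fun j => h' _⟩
  sep s p q t u i j k l hnd hi hj hk hl hc := by
    refine Γ.sep s p q t u _ _ _ _ hnd hi hj hk hl ?_
    have h : ∀ {m n}, (Γ.col s (dihedral a r m) = p ∨ Γ.col s (dihedral a r m) = q) →
        (Γ.col s (dihedral a r n) = t ∨ Γ.col s (dihedral a r n) = u) → m ≠ n := by
      rintro m n hm hn rfl
      grind
    rw [cross_dihedral a r i j k l (h hi hk) (h hi hl) (h hj hk) (h hj hl), hc]

theorem Wins.of_relabel {a : Bool} {r : Fin 6} {s : X} {n : ℕ}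
    (h : (Γ.relabel a r).Wins n s) : Γ.Wins n s := by
  induction n generalizing s with
  | zero => exact GoodPattern.of_dihedral h
  | succ n ih => exact h.imp GoodPattern.of_dihedral fun ⟨s', h1, h2⟩ => ⟨s', h1, ih h2⟩

theorem wins_bdcbec {s : X} {b c d e : Fin 5} (hp : [b, c, d, e, α].Nodup) (h0 : Γ.col s 0 = b)
    (h1 : Γ.col s 1 = d) (h2 : Γ.col s 2 = c) (h3 : Γ.col s 3 = b) (h4 : Γ.col s 4 = e)
    (h5 : Γ.col s 5 = c) : Γ.Wins 2 s := by
  have hp' := hp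
  simp only [List.nodup_cons, List.mem_cons, List.not_mem_nil, or_false, not_or] at hp
  obtain ⟨⟨bc, bd, be, bα⟩, ⟨cd, ce, cα⟩, ⟨de, dα⟩, eα, -⟩ := hp
  by_cases h14 : Γ.conn s d e 1 4
  · have h20 : ¬ Γ.conn s c b 2 0 := Γ.sep s d e c b 1 4 2 0 (by grind)
      (by grind) (by grind) (by grind) (by grind) (by decide) h14
    have h25 : ¬ Γ.conn s c b 2 5 := Γ.sep s d e c b 1 4 2 5 (by grind)
      (by grind) (by grind) (by grind) (by grind) (by decide) h14
    obtain ⟨s', hs, hm, hm1, hm2, hm3, hm4⟩ := exists_move (Ne.symm bc) h2 bα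
    by_cases h23 : Γ.conn s c b 2 3
    · exact Or.inr ⟨s', hs, .of_two 1 0 2 3 5 (by decide) (by decide) (by grind) (by grind)⟩
    · exact Or.inr ⟨s', hs, .of_three 1 2 0 3 (by decide) (by decide) (by decide)
        (by grind) (by grind)⟩
  · by_cases h10 : Γ.conn s d b 1 0
    -- If 1 is linked to both 0 and 3, these two are linked to each other and their chain shields 4
    -- from 2. If only to 0, swapping at 1 gives a rotated `bdceb`.
    · by_cases h13 : Γ.conn s d b 1 3
      · have h03 := Γ.trans s d b 0 1 3 (Γ.symm s d b 1 0 h10) h13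
        have h42 : ¬ Γ.conn s e c 4 2 := Γ.sep s d b e c 0 3 4 2 (by grind)
          (by grind) (by grind) (by grind) (by grind) (by decide) h03
        obtain ⟨s', hs, hm, hm1, hm2, hm3, hm4⟩ := exists_move (Ne.symm ce) h4 cα
        by_cases h45 : Γ.conn s e c 4 5
        · refine Or.inr ⟨s', hs, .of_relabel (a := true) (r := 4)
            (wins_bdceb (b := c) (c := b) (d := e) (e := d) (by grind) ?_ ?_ ?_ ?_ ?_)⟩
          · change Γ.col s' 4 = c
            grind
          · change Γ.col s' 5 = e
            grind
          · change Γ.col s' 0 = b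
            grind
          · change Γ.col s' 1 = d
            grind
          · change Γ.col s' 2 = c
            grind
        · exact Or.inr ⟨s', hs, .of_three 1 2 4 5 (by decide) (by decide) (by decide)
            (by grind) (by grind)⟩
      · obtain ⟨s', hs, hm, hm1, hm2, hm3, hm4⟩ := exists_move (Ne.symm bd) h1 bα
        refine Or.inr ⟨s', hs, .of_relabel (a := true) (r := 3)
          (wins_bdceb (b := b) (c := c) (d := e) (e := d) (by grind) ?_ ?_ ?_ ?_ ?_)⟩
        · change Γ.col s' 3 = b
          grind
        · change Γ.col s' 4 = e
          grind
        · change Γ.col s' 5 = c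
          grind
        · change Γ.col s' 0 = d
          grind
        · change Γ.col s' 1 = b
          grind
    · obtain ⟨s', hs, hm, hm1, hm2, hm3, hm4⟩ := exists_move (Ne.symm bd) h1 bα
      by_cases h13 : Γ.conn s d b 1 3
      · exact Or.inr ⟨s', hs, .of_two 1 0 1 2 5 (by decide) (by decide) (by grind) (by grind)⟩
      · exact Or.inr ⟨s', hs, .of_three 1 0 1 3 (by decide) (by decide) (by decide)
          (by grind) (by grind)⟩

theorem wins_bcdbcd {s : X} {b c d e : Fin 5} (hp : [b, c, d, e, α].Nodup) (h0 : Γ.col s 0 = b)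
    (h1 : Γ.col s 1 = c) (h2 : Γ.col s 2 = d) (h3 : Γ.col s 3 = b) (h4 : Γ.col s 4 = c)
    (h5 : Γ.col s 5 = d) : Γ.Wins 3 s := by
  have hp' := hp
  simp only [List.nodup_cons, List.mem_cons, List.not_mem_nil, or_false, not_or] at hp
  obtain ⟨⟨bc, bd, be, bα⟩, ⟨cd, ce, cα⟩, ⟨de, dα⟩, eα, -⟩ := hp
  by_cases h03 : Γ.conn s b e 0 3
  · have h14 : ¬ Γ.conn s c d 1 4 := Γ.sep s b e c d 0 3 1 4 (by grind)
      (by grind) (by grind) (by grind) (by grind) (by decide) h03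
    have h15 : ¬ Γ.conn s c d 1 5 := Γ.sep s b e c d 0 3 1 5 (by grind)
      (by grind) (by grind) (by grind) (by grind) (by decide) h03
    obtain ⟨s', hs, hm, hm1, hm2, hm3, hm4⟩ := exists_move cd h1 dα
    by_cases h12 : Γ.conn s c d 1 2
    · exact Or.inr ⟨s', hs, .of_two 2 1 5 2 4 (by decide) (by decide) (by grind) (by grind)⟩
    · exact Or.inr ⟨s', hs, .of_three 2 1 2 5 (by decide) (by decide) (by decide)
        (by grind) (by grind)⟩
  -- Bringing the missing color `e` to 0 alone leaves, read from position 5, the type `bdcbec`.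
  · obtain ⟨s', hs, hm, hm1, hm2, hm3, hm4⟩ := exists_move be h0 eα
    refine Or.inr ⟨s', hs, .of_relabel (a := true) (r := 5)
      (wins_bdcbec (b := d) (c := c) (d := e) (e := b) (by grind) ?_ ?_ ?_ ?_ ?_ ?_)⟩
    · change Γ.col s' 5 = d
      grind
    · change Γ.col s' 0 = e
      grind
    · change Γ.col s' 1 = c
      grind
    · change Γ.col s' 2 = d
      grind
    · change Γ.col s' 3 = b
      grind
    · change Γ.col s' 4 = c
      grind

variable (Γ) in
theorem wins_three (s : X) : Γ.Wins 3 s := by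
  -- Discarding `α` leaves four colors, so that the finite case check applies.
  have hex : ∀ i, ∃ a, α.succAbove a = Γ.col s i := fun i =>
    Fin.exists_succAbove_eq (Γ.col_ne s i)
  choose c hc using hex
  obtain ⟨a, r, h⟩ := pattern_cases (c 0) (c 1) (c 2) (c 3) (c 4) (c 5)
  have hvec : ![c 0, c 1, c 2, c 3, c 4, c 5] = c := by
    ext i
    fin_cases i <;> rfl
  simp only [hvec] at h
  have hcol : ∀ i, (Γ.relabel a r).col s i = α.succAbove (c (dihedral a r i)) :=
    fun i => (hc _).symm
  have hcong : ∀ {i j}, c (dihedral a r i) = c (dihedral a r j) →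
      (Γ.relabel a r).col s i = (Γ.relabel a r).col s j := fun h => by rw [hcol, hcol, h]
  have hnd : ∀ {w x y z : Fin 4}, [w, x, y, z].Nodup →
      [α.succAbove w, α.succAbove x, α.succAbove y, α.succAbove z, α].Nodup := by
    intro w x y z h
    have h1 := h.map α.succAbove_right_injective
    have h3 : (List.map α.succAbove [w, x, y, z] ++ [α]).Nodup :=
      List.Nodup.append h1 (List.nodup_singleton _) (by simp)
    exact h3
  apply Wins.of_relabel (a := a) (r := r)
  obtain ⟨h1, h2 | h2 | h2 | h2 | h2 | h2⟩ | ⟨h1, h2 | h2⟩ | ⟨h1, h2, h3⟩ | ⟨h1, h2, h3⟩ |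
    ⟨h1, h2, h3⟩ | ⟨h1, h2, h3, h4⟩ := h
  · exact .of_three 3 0 1 2 (by decide) (by decide) (by decide) (hcong h1) (hcong h2)
  · exact .of_three 3 0 1 3 (by decide) (by decide) (by decide) (hcong h1) (hcong h2)
  · exact .of_two 3 0 1 2 3 (by decide) (by decide) (hcong h1) (hcong h2)
  · exact .of_two 3 0 1 2 4 (by decide) (by decide) (hcong h1) (hcong h2)
  · exact .of_two 3 0 1 2 5 (by decide) (by decide) (hcong h1) (hcong h2)
  · exact .of_two 3 0 1 3 4 (by decide) (by decide) (hcong h1) (hcong h2)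
  · exact .of_three 3 0 2 4 (by decide) (by decide) (by decide) (hcong h1) (hcong h2)
  · exact .of_two 3 0 2 3 5 (by decide) (by decide) (hcong h1) (hcong h2)
  · exact (wins_bcbcde (hnd h3) (hcol 0) (hcol 1) ((hcong h1).symm.trans (hcol 0))
      ((hcong h2).symm.trans (hcol 1)) (hcol 4) (hcol 5)).succ.succ
  · exact (wins_bdceb (hnd h3) (hcol 0) (hcol 1) (hcol 2) (hcol 3)
      ((hcong h1).symm.trans (hcol 0))).succ.succ
  · exact (wins_bdcbec (hnd h3) (hcol 0) (hcol 1) (hcol 2) ((hcong h1).symm.trans (hcol 0))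
      (hcol 4) ((hcong h2).symm.trans (hcol 2))).succ
  · have hmiss : ∀ w x y : Fin 4, [w, x, y].Nodup → ∃ z, [w, x, y, z].Nodup := by decide
    obtain ⟨z, hz⟩ := hmiss _ _ _ h4
    exact wins_bcdbcd (hnd hz) (hcol 0) (hcol 1) (hcol 2) ((hcong h1).symm.trans (hcol 0))
      ((hcong h2).symm.trans (hcol 1)) ((hcong h3).symm.trans (hcol 2))

end HexGame

/-! ### Gluing neighbors of finished hubs, and separation of glued chains. -/

section Glue

variable {V : Type*} {G : SimpleGraph V} {R : RotationSystem G} {W : Set V}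
  (H : ∀ w : W, R.Hub (w : V)) (g : W → Set (Fin 6 × Fin 6)) {k : ℕ}

/-- The neighbor of a hub at a given position. -/
def nbr (w : W) (i : Fin 6) : V := ((H w).dart i).snd

/-- Glued neighbors of a common hub have the same color. -/
def Respects (ψ : G.Coloring (Fin k)) : Prop :=
  ∀ w, ∀ e ∈ g w, ψ (nbr H w e.1) = ψ (nbr H w e.2)

/-- Disjoint pairs of glued neighbors of a common hub do not cross. -/
def NonCrossing : Prop :=
  ∀ w, ∀ e ∈ g w, ∀ e' ∈ g w, e.1 ≠ e'.1 → e.1 ≠ e'.2 → e.2 ≠ e'.1 → e.2 ≠ e'.2 →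
    cross e.1 e.2 e'.1 e'.2 = 0

/-- Vertices colored with `p` or `q` that are adjacent or glued. -/
def Link (ψ : G.Coloring (Fin k)) (p q : Fin k) (x y : V) : Prop :=
  (ψ x = p ∨ ψ x = q) ∧ (ψ y = p ∨ ψ y = q) ∧
    (G.Adj x y ∨ ∃ w, ∃ e ∈ g w, x = nbr H w e.1 ∧ y = nbr H w e.2)

/-- Vertices in the same chain after gluing. -/
def Linked (ψ : G.Coloring (Fin k)) (p q : Fin k) : V → V → Prop :=
  Relation.EqvGen (Link H g ψ p q)

variable {H g}

theorem Linked.color {ψ : G.Coloring (Fin k)} {p q : Fin k} {x y : V} (h : Linked H g ψ p q x y) :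
    (ψ x = p ∨ ψ x = q) ↔ (ψ y = p ∨ ψ y = q) := by
  induction h with
  | rel x y h => exact ⟨fun _ => h.2.1, fun _ => h.1⟩
  | refl => rfl
  | symm _ _ _ ih => exact ih.symm
  | trans _ _ _ _ _ ih ih' => exact ih.trans ih'

theorem nbr_ne_color {ψ : G.Coloring (Fin k)} {α : Fin k} (hα : ∀ w : W, ψ w = α) (w : W)
    (i : Fin 6) : ψ (nbr H w i) ≠ α := by
  rw [← hα w]
  exact (ψ.valid ((H w).adj i)).symm

/-- A chain in the colors `p` and `q` can be swapped by Kempe changes, also after gluing. -/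
theorem exists_swap_linked [Finite V] {α p q : Fin k} (hpq : p ≠ q) (hp : p ≠ α) (hq : q ≠ α)
    {ψ : G.Coloring (Fin k)} (hψ : Respects H g ψ) {x : V} (hx : ψ x = p ∨ ψ x = q) :
    ∃ (ψ' : G.Coloring (Fin k)) (t : V → ℕ), Recolors α ψ ψ' t ∧ (∀ w, t w ≤ 1) ∧
      Respects H g ψ' ∧ ∀ y, (Linked H g ψ p q x y → ψ' y = Equiv.swap p q (ψ y)) ∧
        (¬ Linked H g ψ p q x y → ψ' y = ψ y) := by
  obtain ⟨ψ', t, h, h1, h2⟩ := Recolors.exists_swap hpq hp hq ψ {y | Linked H g ψ p q x y}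
    (fun y hy => (Linked.color hy).1 hx) (fun y hy z hyz hz => Relation.EqvGen.trans _ _ _ hy
      (.rel _ _ ⟨(Linked.color hy).1 hx, hz, Or.inl hyz⟩))
  refine ⟨ψ', t, h, fun w => ?_, fun w e he => ?_, fun y => ⟨fun hy => (h1 y hy).1,
    fun hy => (h2 y hy).1⟩⟩
  · by_cases hw : Linked H g ψ p q x w
    · exact (h1 w hw).2
    · exact (h2 w hw).2.trans_le zero_le_one
  · have hiff : Linked H g ψ p q x (nbr H w e.1) ↔ Linked H g ψ p q x (nbr H w e.2) := by
      have hl : (ψ (nbr H w e.1) = p ∨ ψ (nbr H w e.1) = q) →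
          Linked H g ψ p q (nbr H w e.1) (nbr H w e.2) := fun hc =>
        .rel _ _ ⟨hc, hψ w e he ▸ hc, Or.inr ⟨w, e, he, rfl, rfl⟩⟩
      constructor
      · exact fun h => h.trans _ _ _ (hl ((Linked.color h).1 hx))
      · exact fun h => h.trans _ _ _ ((hl (hψ w e he ▸ (Linked.color h).1 hx)).symm _ _)
    by_cases hw : Linked H g ψ p q x (nbr H w e.1)
    · rw [(h1 _ hw).1, (h1 _ (hiff.1 hw)).1, hψ w e he]
    · rw [(h2 _ hw).1, (h2 _ fun h => hw (hiff.2 h)).1, hψ w e he]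

section Separation

variable {ψ : G.Coloring (Fin k)} {α p q : Fin k}

theorem edgeChain_hub_self (w : W) (i m : Fin 6) :
    edgeChain ((H w).dart i) ((H w).dart m) = (Pi.single i 1 : Fin 6 → ZMod 2) m := by
  by_cases h : m = i
  · subst h
    simp [edgeChain]
  · rw [Pi.single_eq_of_ne h]
    refine edgeChain_ne (fun h' => h ((H w).injective h')) fun h' => ?_
    have h1 : ((H w).dart m).fst = ((H w).dart i).snd := by rw [h']; rfl
    rw [(H w).dart_fst] at h1
    exact ((H w).adj i).ne h1

theorem edgeChain_hub_ne (hα : ∀ w : W, ψ w = α) {w w' : W} (h : w ≠ w') (i m : Fin 6) :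
    edgeChain ((H w').dart i) ((H w).dart m) = 0 := by
  refine edgeChain_ne (fun h' => h (Subtype.ext ?_)) fun h' => ?_
  · rw [← (H w).dart_fst m, h', (H w').dart_fst]
  · refine nbr_ne_color hα w' i (H := H) ?_
    have h1 : ((H w).dart m).fst = nbr H w' i := by rw [h']; rfl
    rw [← h1, (H w).dart_fst, hα]

variable [Fintype V]

open scoped Classical in
theorem boundary_edgeChain_hub (w : W) (i : Fin 6) (r : V) :
    boundary G (edgeChain ((H w).dart i)) r =
      (if r = w then 1 else 0) + if r = nbr H w i then 1 else 0 := by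
  rw [boundary_edgeChain, (H w).dart_fst]
  rfl

open scoped Classical in
/-- Linked vertices are joined by a path, which passes through a hub only between glued
neighbors. -/
theorem Linked.exists_chain (hα : ∀ w : W, ψ w = α) (hp : p ≠ α) (hq : q ≠ α)
    (hg : NonCrossing g) (hψ : Respects H g ψ) {u : W} (hu : g u = ∅) {x y : V}
    (h : Linked H g ψ p q x y) :
    ∃ z : G.Dart → ZMod 2, (∀ d, z d.symm = z d) ∧
      (∀ r, boundary G z r = (if r = x then 1 else 0) + if r = y then 1 else 0) ∧
      (∀ d, ψ d.fst ≠ p → ψ d.fst ≠ q → ψ d.fst ≠ α → z d = 0) ∧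
      (∀ d : G.Dart, d.fst = (u : V) → z d = 0) ∧
      ∀ w, ∀ e ∈ g w, ψ (nbr H w e.1) ≠ p → ψ (nbr H w e.1) ≠ q →
        sumBefore (fun m => z ((H w).dart m)) e.1 +
          sumBefore (fun m => z ((H w).dart m)) e.2 = 0 := by
  have hnα : ∀ {x}, (ψ x = p ∨ ψ x = q) → ψ x ≠ α := by
    rintro x (h | h) <;> rwa [h]
  have hzero : ∀ a, sumBefore (fun _ => 0) a = 0 := fun a => by simp [sumBefore]
  induction h with
  | refl x => exact ⟨0, by simp, fun r => by
      rw [map_zero, CharTwo.add_self_eq_zero, Pi.zero_apply], by simp, by simp,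
      fun w e _ _ _ => by simp [sumBefore]⟩
  | symm x y _ ih =>
    obtain ⟨z, h1, h2, h3⟩ := ih
    exact ⟨z, h1, fun r => (h2 r).trans (add_comm _ _), h3⟩
  | trans x y y' _ _ ih ih' =>
    obtain ⟨z, h1, h2, h3, h4, h5⟩ := ih
    obtain ⟨z', h1', h2', h3', h4', h5'⟩ := ih'
    refine ⟨z + z', fun d => ?_, fun r => ?_, fun d hd hd' hd'' => ?_, fun d hd => ?_,
      fun w e he hp hq => ?_⟩
    · rw [Pi.add_apply, Pi.add_apply, h1, h1']
    · rw [map_add, Pi.add_apply, h2, h2']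
      linear_combination CharTwo.add_self_eq_zero (if r = y then (1 : ZMod 2) else 0)
    · rw [Pi.add_apply, h3 d hd hd' hd'', h3' d hd hd' hd'', add_zero]
    · rw [Pi.add_apply, h4 d hd, h4' d hd, add_zero]
    · have hs : (fun m => (z + z') ((H w).dart m)) = (fun m => z ((H w).dart m)) +
        fun m => z' ((H w).dart m) := rfl
      rw [hs, sumBefore_add, sumBefore_add]
      linear_combination h5 w e he hp hq + h5' w e he hp hq
  | rel x y h =>
    obtain ⟨hx, hy, hxy | ⟨w, e, he, rfl, rfl⟩⟩ := h
    · have hout : ∀ d : G.Dart, ψ d.fst ≠ p ∧ ψ d.fst ≠ q ∨ ψ d.fst = α →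
          edgeChain ⟨(x, y), hxy⟩ d = 0 := by
        intro d hd
        refine edgeChain_ne ?_ ?_
        · rintro rfl
          exact hd.elim (fun h => by tauto) (hnα hx)
        · rintro rfl
          exact hd.elim (fun h => by tauto) (hnα hy)
      have hhub : ∀ w : W, (fun m => edgeChain ⟨(x, y), hxy⟩ ((H w).dart m)) = fun _ => 0 :=
        fun w => funext fun m => hout _ (Or.inr (by rw [(H w).dart_fst, hα]))
      refine ⟨edgeChain ⟨(x, y), hxy⟩, edgeChain_symm _, boundary_edgeChain _,
        fun d h1 h2 _ => hout d (Or.inl ⟨h1, h2⟩), fun d hd => hout d (Or.inr (by rw [hd, hα])),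
        fun w e _ _ _ => ?_⟩
      rw [hhub, hzero, hzero, add_zero]
    · have hwu : w ≠ u := by
        rintro rfl
        rw [hu] at he
        exact he
      have hout : ∀ i, (ψ (nbr H w i) = p ∨ ψ (nbr H w i) = q) → ∀ d : G.Dart,
          (ψ d.fst ≠ p ∧ ψ d.fst ≠ q ∧ ψ d.fst ≠ α) → edgeChain ((H w).dart i) d = 0 := by
        intro i hi d hd
        refine edgeChain_ne ?_ ?_
        · rintro rfl
          rw [(H w).dart_fst, hα] at hd
          exact hd.2.2 rfl
        · rintro rfl
          change ψ (nbr H w i) ≠ p ∧ ψ (nbr H w i) ≠ q ∧ _ at hd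
          tauto
      have hu' : ∀ i, ∀ d : G.Dart, d.fst = u → edgeChain ((H w).dart i) d = 0 := by
        intro i d hd
        obtain ⟨m, rfl⟩ := (H u).surjective d hd
        exact edgeChain_hub_ne hα hwu.symm i m
      refine ⟨edgeChain ((H w).dart e.1) + edgeChain ((H w).dart e.2), fun d => ?_, fun r => ?_,
        fun d h1 h2 h3 => ?_, fun d hd => ?_, fun w' e' he' h1 h2 => ?_⟩
      · rw [Pi.add_apply, Pi.add_apply, edgeChain_symm, edgeChain_symm]
      · rw [map_add, Pi.add_apply, boundary_edgeChain_hub, boundary_edgeChain_hub]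
        linear_combination CharTwo.add_self_eq_zero (if r = w then (1 : ZMod 2) else 0)
      · rw [Pi.add_apply, hout _ hx d ⟨h1, h2, h3⟩, hout _ hy d ⟨h1, h2, h3⟩, add_zero]
      · rw [Pi.add_apply, hu' _ d hd, hu' _ d hd, add_zero]
      · by_cases hw : w' = w
        · subst hw
          have hs : (fun m => (edgeChain ((H w').dart e.1) + edgeChain ((H w').dart e.2))
              ((H w').dart m)) = Pi.single e.1 1 + Pi.single e.2 1 := by
            ext m
            rw [Pi.add_apply, edgeChain_hub_self, edgeChain_hub_self, Pi.add_apply]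
          have h1' := hψ w' e' he' ▸ h1
          have h2' := hψ w' e' he' ▸ h2
          have hne : ∀ {i j : Fin 6}, (ψ (nbr H w' i) = p ∨ ψ (nbr H w' i) = q) →
              ψ (nbr H w' j) ≠ p → ψ (nbr H w' j) ≠ q → i ≠ j := by
            rintro i j h h' h'' rfl
            tauto
          rw [hs, sumBefore_add, sumBefore_add]
          simp only [sumBefore_single]
          -- The path runs through the hub between the ends of `e`, and `e'` does not cross `e`; the
          -- ends are distinct because their colors are.
          rw [cross_mul, hg w' e he e' he' (hne hx h1 h2) (hne hx h1' h2') (hne hy h1 h2)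
            (hne hy h1' h2'), mul_zero]
        · have hs : (fun m => (edgeChain ((H w).dart e.1) + edgeChain ((H w).dart e.2))
              ((H w').dart m)) = fun _ => 0 := by
            ext m
            rw [Pi.add_apply, edgeChain_hub_ne hα hw, edgeChain_hub_ne hα hw, add_zero]
          rw [hs, hzero, hzero, add_zero]

/-- Chains in disjoint pairs of colors do not cross at a hub without glued neighbors. -/
theorem not_linked_of_linked (hR : R.IsPlane) (hα : ∀ w : W, ψ w = α) (hg : NonCrossing g)
    (hψ : Respects H g ψ) {u : W} (hu : g u = ∅) {r s : Fin k} (hnd : [p, q, r, s, α].Nodup)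
    {i j a b : Fin 6} (hi : ψ (nbr H u i) = p ∨ ψ (nbr H u i) = q)
    (hj : ψ (nbr H u j) = p ∨ ψ (nbr H u j) = q) (ha : ψ (nbr H u a) = r ∨ ψ (nbr H u a) = s)
    (hb : ψ (nbr H u b) = r ∨ ψ (nbr H u b) = s) (hc : cross i j a b = 1)
    (hl : Linked H g ψ p q (nbr H u i) (nbr H u j)) :
    ¬ Linked H g ψ r s (nbr H u a) (nbr H u b) := by
  classical
  intro hl'
  simp only [List.nodup_cons, List.mem_cons, List.not_mem_nil, or_false, not_or] at hnd
  obtain ⟨⟨pq, pr, ps, pα⟩, ⟨qr, qs, qα⟩, ⟨rs, rα⟩, sα, -⟩ := hnd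
  have hrs : ∀ x, (ψ x = r ∨ ψ x = s) → ψ x ≠ p ∧ ψ x ≠ q ∧ ψ x ≠ α := by
    rintro x (h | h) <;> rw [h]
    · exact ⟨Ne.symm pr, Ne.symm qr, rα⟩
    · exact ⟨Ne.symm ps, Ne.symm qs, sα⟩
  obtain ⟨z, z1, z2, z3, z4, z5⟩ := Linked.exists_chain hα pα qα hg hψ hu hl
  -- The path from neighbor `i` to neighbor `j` is closed up through `u`. It avoids `u` itself
  -- because nothing is glued there.
  set ζ := z + edgeChain ((H u).dart i) + edgeChain ((H u).dart j) with hζ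
  have ζsymm : ∀ d, ζ d.symm = ζ d := fun d => by
    simp only [hζ, Pi.add_apply, z1, edgeChain_symm]
  have ζb : ∀ r, boundary G ζ r = 0 := by
    intro r
    rw [hζ, map_add, map_add, Pi.add_apply, Pi.add_apply, z2, boundary_edgeChain_hub,
      boundary_edgeChain_hub]
    generalize (if r = nbr H u i then (1 : ZMod 2) else 0) = x,
      (if r = nbr H u j then (1 : ZMod 2) else 0) = y, (if r = u then (1 : ZMod 2) else 0) = v
    linear_combination CharTwo.add_self_eq_zero x + CharTwo.add_self_eq_zero y +
      CharTwo.add_self_eq_zero v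
  obtain ⟨f, hf1, hf2⟩ := R.isPlane_iff.1 hR ζ ζsymm ζb
  have ζ0 : ∀ d : G.Dart, (ψ d.fst = r ∨ ψ d.fst = s) → ζ d = 0 := by
    intro d hd
    obtain ⟨hdp, hdq, hdα⟩ := hrs _ hd
    have he : ∀ i, (ψ (nbr H u i) = p ∨ ψ (nbr H u i) = q) → edgeChain ((H u).dart i) d = 0 := by
      intro i hi
      refine edgeChain_ne ?_ ?_
      · rintro rfl
        rw [(H u).dart_fst, hα] at hdα
        exact hdα rfl
      · rintro rfl
        exact hi.elim hdp hdq
    rw [hζ, Pi.add_apply, Pi.add_apply, z3 d hdp hdq hdα, he i hi, he j hj, add_zero, add_zero]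
  have ζhub : ∀ w, w ≠ u → (fun m => ζ ((H w).dart m)) = fun m => z ((H w).dart m) := by
    intro w hw
    ext m
    rw [hζ, Pi.add_apply, Pi.add_apply, edgeChain_hub_ne hα hw, edgeChain_hub_ne hα hw, add_zero,
      add_zero]
  have ζu : (fun m => ζ ((H u).dart m)) = Pi.single i 1 + Pi.single j 1 := by
    ext m
    rw [hζ, Pi.add_apply, Pi.add_apply, z4 _ ((H u).dart_fst m), edgeChain_hub_self,
      edgeChain_hub_self, zero_add, Pi.add_apply]
  have fsymm : ∀ d : G.Dart, (ψ d.fst = r ∨ ψ d.fst = s) → f d.symm = f d := by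
    intro d hd
    have := hf2 d
    rw [ζ0 d hd] at this
    exact (CharTwo.add_eq_zero.1 this).symm
  -- The side of the closed curve on which a vertex off it lies; the default 0 only concerns
  -- isolated vertices.
  let F : V → ZMod 2 := fun x => if h : ∃ d : G.Dart, d.fst = x then f h.choose else 0
  have hF : ∀ d : G.Dart, (ψ d.fst = r ∨ ψ d.fst = s) → F d.fst = f d := by
    intro d hd
    have h : ∃ d' : G.Dart, d'.fst = d.fst := ⟨d, rfl⟩
    simp only [F, dif_pos h]
    refine R.apply_eq_of_fst_eq (fun d' hd' => ?_) h.choose_spec rfl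
    rw [hf1, ζ0 d' (by rwa [hd']), add_zero]
  have hFn : ∀ w i, (ψ (nbr H w i) = r ∨ ψ (nbr H w i) = s) →
      F (nbr H w i) = f ((H w).dart i) := fun w i h => by
    have h1 := fsymm ((H w).dart i).symm h
    rw [SimpleGraph.Dart.symm_symm] at h1
    exact (hF ((H w).dart i).symm h).trans h1.symm
  have key : ∀ x y, Linked H g ψ r s x y → F x = F y := by
    intro x y h
    induction h with
    | refl => rfl
    | symm _ _ _ ih => exact ih.symm
    | trans _ _ _ _ _ ih ih' => exact ih.trans ih'
    | rel x y h =>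
      obtain ⟨hx, hy, hxy | ⟨w, e, he, rfl, rfl⟩⟩ := h
      · exact (hF ⟨(x, y), hxy⟩ hx).trans ((fsymm ⟨(x, y), hxy⟩ hx).symm.trans
          (hF ⟨(y, x), hxy.symm⟩ hy).symm)
      · have hwu : w ≠ u := by
          rintro rfl
          rw [hu] at he
          exact he
        -- A jump at another hub does not change sides, since the curve does not separate the glued
        -- positions there.
        rw [hFn _ _ hx, hFn _ _ hy, ← CharTwo.add_eq_zero, (H w).add_eq_sumBefore hf1, ζhub w hwu]
        exact z5 w e he (hrs _ hx).1 (hrs _ hx).2.1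
  have h1 := key _ _ hl'
  -- At `u` the curve uses just the darts `i` and `j`, so the crossing chord joins opposite sides, a
  -- contradiction.
  rw [hFn _ _ ha, hFn _ _ hb, ← CharTwo.add_eq_zero, (H u).add_eq_sumBefore hf1, ζu,
    sumBefore_add, sumBefore_add] at h1
  simp only [sumBefore_single] at h1
  rw [cross_mul, hc] at h1
  exact absurd h1 (by decide)

end Separation

end Glue

/-- The chords witnessing goodness are recorded, so that goodness depends only on their ends
remaining alike. With three equal colors the two recorded chords share an end, so there is nothing
to cross. -/
theorem GoodPattern.exists_glue {κ : Type*} {c : Fin 6 → κ} (h : GoodPattern c) :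
    ∃ A : Set (Fin 6 × Fin 6), (∀ e ∈ A, c e.1 = c e.2) ∧
      (∀ e ∈ A, ∀ e' ∈ A, e.1 ≠ e'.1 → e.1 ≠ e'.2 → e.2 ≠ e'.1 → e.2 ≠ e'.2 →
        cross e.1 e.2 e'.1 e'.2 = 0) ∧
      ∀ c' : Fin 6 → κ, (∀ e ∈ A, c' e.1 = c' e.2) → GoodPattern c' := by
  obtain ⟨i, j, k, hij, hik, hjk, h1, h2⟩ | ⟨i, j, k, l, hnd, hc, h1, h2⟩ := h
  · refine ⟨{(i, j), (i, k)}, ?_, ?_, fun c' h => ?_⟩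
    · rintro e (rfl | rfl) <;> assumption
    · rintro e (rfl | rfl) e' (rfl | rfl) h <;> exact absurd rfl h
    · exact Or.inl ⟨i, j, k, hij, hik, hjk, h (i, j) (Or.inl rfl), h (i, k) (Or.inr rfl)⟩
  · refine ⟨{(i, j), (k, l)}, ?_, ?_, fun c' h => ?_⟩
    · rintro e (rfl | rfl) <;> assumption
    · rintro e (rfl | rfl) e' (rfl | rfl) h h' h'' h'''
      · exact absurd rfl h
      · exact hc
      · rw [cross_comm (Ne.symm h) (Ne.symm h'') (Ne.symm h') (Ne.symm h''')]
        exact hc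
      · exact absurd rfl h
    · exact Or.inr ⟨i, j, k, l, hnd, hc, h (i, j) (Or.inl rfl), h (k, l) (Or.inr rfl)⟩

/-! ### Treating the hubs one after another. -/

section

variable {V : Type*} [Fintype V] {G : SimpleGraph V} {R : RotationSystem G}

theorem isGood_of_goodPattern (hR : R.IsPlane) {u : V} (H : R.Hub u) {ψ : G.Coloring (Fin 5)}
    (h : GoodPattern fun i => ψ (H.dart i).snd) : IsGood ψ u := by
  obtain ⟨i, j, k, hij, hik, hjk, h1, h2⟩ | ⟨i, j, k, l, hnd, hc, h1, h2⟩ := h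
  · exact Or.inl ⟨_, _, _, H.adj i, H.adj j, H.adj k, H.snd_injective.ne hij,
      H.snd_injective.ne hik, H.snd_injective.ne hjk, h1, h2⟩
  · have hu : ∀ i, (H.dart i).snd ∈ ({u}ᶜ : Set V) := fun i => (H.adj i).ne'
    refine Or.inr ⟨⟨_, hu i⟩, ⟨_, hu j⟩, ⟨_, hu k⟩, ⟨_, hu l⟩, H.adj i, H.adj j, H.adj k, H.adj l,
      hnd.map (f := fun i => (⟨_, hu i⟩ : ({u}ᶜ : Set V)))
        -- The ends of each chord have equal colors, hence are nonadjacent, as the chord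
        -- construction requires.
        fun a b hab => H.snd_injective (congrArg Subtype.val hab), h1, h2, ?_⟩
    exact nonOverlapping_of_cross hR H hnd hc _ _ _ _ rfl rfl rfl rfl
      (fun h => ψ.valid h h1) fun h => ψ.valid h h2

variable {W : Set V} {H : ∀ w : W, R.Hub (w : V)} {g : W → Set (Fin 6 × Fin 6)} {α : Fin 5}

/-- The recolorings of the neighbors of a hub, keeping glued vertices alike. -/
def hubGame (hR : R.IsPlane) (hg : NonCrossing g) {u : W} (hu : g u = ∅) :
    HexGame α {ψ : G.Coloring (Fin 5) // Respects H g ψ ∧ ∀ w : W, ψ w = α} where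
  col s i := s.1 (nbr H u i)
  conn s p q i j := Linked H g s.1 p q (nbr H u i) (nbr H u j)
  Step s s' := ∃ t, Recolors α s.1 s'.1 t ∧ ∀ w, t w ≤ 1
  col_ne s i := nbr_ne_color s.2.2 u i
  refl _ _ _ _ := .refl _
  symm _ _ _ _ _ h := h.symm _ _
  trans _ _ _ _ _ _ h h' := h.trans _ _ _ h'
  move s p q i hpq hp hq hi := by
    obtain ⟨ψ', t, h, ht, hψ', h'⟩ := exists_swap_linked hpq hp hq s.2.1 hi
    exact ⟨⟨ψ', hψ', fun w => h.apply_eq (s.2.2 w)⟩, ⟨t, h, ht⟩, fun j => h' _⟩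
  sep s _ _ _ _ _ _ _ _ hnd hi hj hk hl hc h :=
    not_linked_of_linked hR s.2.2 hg s.2.1 hu hnd hi hj hk hl hc h

theorem exists_recolors_goodPattern (hR : R.IsPlane) (hg : NonCrossing g) {u : W} (hu : g u = ∅)
    {ψ : G.Coloring (Fin 5)} (hψ : Respects H g ψ) (hα : ∀ w : W, ψ w = α) :
    ∃ (ψ' : G.Coloring (Fin 5)) (t : V → ℕ), Recolors α ψ ψ' t ∧ (∀ w, t w ≤ 3) ∧
      Respects H g ψ' ∧ GoodPattern fun i => ψ' (nbr H u i) := by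
  have key : ∀ n s, (hubGame (H := H) (α := α) hR hg hu).Wins n s →
      ∃ s' : {ψ : G.Coloring (Fin 5) // Respects H g ψ ∧ ∀ w : W, ψ w = α}, ∃ t : V → ℕ,
        Recolors α s.1 s'.1 t ∧ (∀ w, t w ≤ n) ∧ GoodPattern fun i => s'.1 (nbr H u i) := by
    intro n
    induction n with
    | zero => exact fun s h => ⟨s, 0, .refl _, fun _ => le_rfl, h⟩
    | succ n ih =>
      rintro s (h | ⟨s', ⟨t, h1, h2⟩, h3⟩)
      · exact ⟨s, 0, .refl _, fun _ => Nat.zero_le _, h⟩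
      · obtain ⟨s'', t', h4, h5, h6⟩ := ih s' h3
        refine ⟨s'', t + t', h1.trans h4, fun w => ?_, h6⟩
        rw [Pi.add_apply, add_comm n 1]
        exact add_le_add (h2 w) (h5 w)
  obtain ⟨s', t, h1, h2, h3⟩ := key 3 ⟨ψ, hψ, hα⟩ (HexGame.wins_three _ _)
  exact ⟨s'.1, t, h1, h2, s'.2.1, h3⟩

/-- Induction on the set of finished hubs. The gluings at earlier hubs are respected while the next
one, still unglued, is repaired; then its own witnesses are glued. -/
theorem exists_recolors_forall_goodPattern (hR : R.IsPlane) (φ : G.Coloring (Fin 5))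
    (hα : ∀ w : W, φ w = α) (J : Finset W) :
    ∃ (ψ : G.Coloring (Fin 5)) (t : V → ℕ) (g : W → Set (Fin 6 × Fin 6)), Recolors α φ ψ t ∧
      (∀ w, t w ≤ 3 * J.card) ∧ Respects H g ψ ∧ NonCrossing g ∧ (∀ w ∉ J, g w = ∅) ∧
      ∀ w ∈ J, ∀ c : Fin 6 → Fin 5, (∀ e ∈ g w, c e.1 = c e.2) → GoodPattern c := by
  classical
  induction J using Finset.induction_on with
  | empty =>
    exact ⟨φ, 0, fun _ => ∅, .refl _, by simp, fun w e he => he.elim, fun w e he => he.elim,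
      fun _ _ => rfl, by simp⟩
  | insert u J huJ ih =>
    obtain ⟨ψ, t, g, h1, h2, h3, h4, h5, h6⟩ := ih
    obtain ⟨ψ', t', k1, k2, k3, k4⟩ := exists_recolors_goodPattern (H := H) hR h4 (h5 u huJ) h3
      fun w => h1.apply_eq (hα w)
    obtain ⟨A, A1, A2, A3⟩ := k4.exists_glue
    refine ⟨ψ', t + t', Function.update g u A, h1.trans k1, fun w => ?_, fun w => ?_, fun w => ?_,
      fun w hw => ?_, fun w hw => ?_⟩
    · rw [Finset.card_insert_of_notMem huJ, Pi.add_apply, mul_add]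
      exact add_le_add (h2 w) (k2 w)
    · by_cases hw : w = u
      · subst hw
        rw [Function.update_self]
        exact A1
      · rw [Function.update_of_ne hw]
        exact k3 w
    · by_cases hw : w = u
      · subst hw
        rw [Function.update_self]
        exact A2
      · rw [Function.update_of_ne hw]
        exact h4 w
    · rw [Finset.mem_insert, not_or] at hw
      rw [Function.update_of_ne hw.1]
      exact h5 w hw.2
    · by_cases hwu : w = u
      · subst hwu
        rw [Function.update_self]
        exact A3
      · rw [Function.update_of_ne hwu]
        exact h6 w ((Finset.mem_insert.1 hw).resolve_left hwu)

end

end Kempe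

theorem mainTheorem5 {V : Type*} [Fintype V] [DecidableEq V] (N : SimpleGraph V)
    [DecidableRel N.Adj] (hN : Kempe.IsPlanar N) (φ : N.Coloring (Fin 5))
    (I : Finset V) (hI : N.IsIndepSet (I : Set V)) (α : Fin 5) (hα : ∀ v ∈ I, φ v = α)
    (hdeg : ∀ v ∈ I, N.degree v ≤ 6) :
    ∃ (ψ : N.Coloring (Fin 5)) (m : ℕ) (c : ℕ → N.Coloring (Fin 5)),
      -- every vertex of `I` (of degree 6) is good for the final coloring
      (∀ v ∈ I, N.degree v = 6 → Kempe.IsGood ψ v) ∧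
      -- a sequence of `m` Kempe changes from `φ` to `ψ`
      c 0 = φ ∧ c m = ψ ∧ (∀ i < m, Kempe.KempeChange (c i) (c (i + 1))) ∧
      -- no vertex ever changes its color to `α`
      (∀ i < m, ∀ w, c (i + 1) w ≠ c i w → c (i + 1) w ≠ α) ∧
      -- the vertices of `I` are never recolored
      (∀ i ≤ m, ∀ v ∈ I, c i v = α) ∧
      -- every vertex changes its color at most `3 |I|` times
      ∀ w, ((Finset.range m).filter fun i => c (i + 1) w ≠ c i w).card ≤ 3 * I.card := by
  obtain ⟨R, hR⟩ := hN
  let J : Finset V := I.filter fun v => N.degree v = 6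
  have H : ∀ w : (J : Set V), R.Hub (w : V) := fun w =>
    (R.exists_hub (Finset.mem_filter.1 w.2).2).some
  -- Only the vertices of degree 6 serve as hubs, and there are at most `I.card` of them.
  obtain ⟨ψ, t, g, h1, h2, h3, -, -, h4⟩ := Kempe.exists_recolors_forall_goodPattern (H := H) hR φ
    (fun w => hα w (Finset.mem_filter.1 w.2).1) Finset.univ
  obtain ⟨m, c, c0, cm, hk, hc, hf, ht⟩ := h1.exists_sequence
  refine ⟨ψ, m, c, fun v hv hv6 => ?_, c0, cm, hk, hc, fun i hi v hv => hf i hi v (hα v hv),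
    fun w => ?_⟩
  · let v' : (J : Set V) := ⟨v, Finset.mem_filter.2 ⟨hv, hv6⟩⟩
    exact Kempe.isGood_of_goodPattern hR (H v') (h4 v' (Finset.mem_univ _) _ (h3 v'))
  · rw [ht w]
    refine (h2 w).trans (Nat.mul_le_mul_left 3 ?_)
    rw [Finset.card_univ, ← Set.toFinset_card, Finset.toFinset_coe]
    exact Finset.card_filter_le _ _
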